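/- **Proposition (stable classification of linking matrices).** For a symmetric integral matrix $A\in M_n(\mathbb Z)$, $n\ge 0$, let $G(A)=\mathbb Z^n/A\mathbb Z^n$, let $\mathrm{Tor}(G(A))$ be its torsion subgroup, and let $b_1(A)=\mathrm{rk}_{\mathbb Z}\ker(A\colon\mathbb Z^n\to\mathbb Z^n)$. The torsion linking pairing $$\lambda_A\colon \mathrm{Tor}(G(A))\times \mathrm{Tor}(G(A))\to\mathbb Q/\mathbb Z$$ is the well-defined symmetric bilinear pairing $\lambda_A(\xi,\eta)=u^{\mathsf T}Av \bmod \mathbb Z$, where $u,v\in\mathbb Q^n$ are any rational vectors such that $Au,Av$ lie in $\mathbb Z^n$ and represent $\xi,\eta$. (If $\det A\ne 0$ this is $\lambda_A([x],[y])=x^{\mathsf T}A^{-1}y\bmod\mathbb Z$; in general it is the pairing of the nonsingular block $A_{\mathrm{red}}$ of any splitting $P^{\mathsf T}AP=0\oplus A_{\mathrm{red}}$ with $P\in GL_n(\mathbb Z)$, transported to $\mathrm{Tor}(G(A))$.) Two symmetric integral matrices $A$, $A'$, possibly of different sizes, are *Kirby stably congruent* if there are integers $r,s,r',s'\ge 0$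 and a unimodular integral matrix $P$ with $$P^{\mathsf T}\bigl(A\oplus I_r\oplus(-I_s)\bigr)P=A'\oplus I_{r'}\oplus(-I_{s'}).$$ Let $A,A'$ be symmetric integral matrices. The following are equivalent: (a) $A$ and $A'$ are Kirby stably congruent. (b) $b_1(A)=b_1(A')$, and there is a group isomorphism $\varphi\colon\mathrm{Tor}(G(A))\to\mathrm{Tor}(G(A'))$ with $\lambda_{A'}(\varphi(\xi),\varphi(\eta))=\lambda_A(\xi,\eta)$ for all $\xi,\eta\in\mathrm{Tor}(G(A))$. -/

import Mathlib

namespace Kirby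

open Matrix

section Definitions

variable {ι : Type*} [Fintype ι]

/-- The block sum `A ⊕ I_r ⊕ (-I_s)`. -/
def stabilize (A : Matrix ι ι ℤ) (r s : ℕ) :
    Matrix (ι ⊕ (Fin r ⊕ Fin s)) (ι ⊕ (Fin r ⊕ Fin s)) ℤ :=
  Matrix.fromBlocks A 0 0
    (Matrix.fromBlocks (1 : Matrix (Fin r) (Fin r) ℤ) 0 0 (-1 : Matrix (Fin s) (Fin s) ℤ))

/-- Kirby stable congruence: `Pᵀ (A ⊕ I_r ⊕ (-I_s)) P = A' ⊕ I_r' ⊕ (-I_s')` with `P` unimodular.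
The bijection `e` only identifies the index sets of the two (equally large) square matrices. -/
def StablyCongruent {n m : ℕ} (A : Matrix (Fin n) (Fin n) ℤ) (A' : Matrix (Fin m) (Fin m) ℤ) :
    Prop :=
  ∃ (r s r' s' : ℕ) (e : (Fin n ⊕ (Fin r ⊕ Fin s)) ≃ (Fin m ⊕ (Fin r' ⊕ Fin s')))
    (P : Matrix (Fin n ⊕ (Fin r ⊕ Fin s)) (Fin n ⊕ (Fin r ⊕ Fin s)) ℤ),
    IsUnit P.det ∧ Matrix.reindex e e (Pᵀ * stabilize A r s * P) = stabilize A' r' s'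

/-- The cokernel `G(A) = ℤⁿ / A ℤⁿ`. -/
abbrev Coker (A : Matrix ι ι ℤ) : Type _ := (ι → ℤ) ⧸ LinearMap.range A.mulVecLin

/-- The class in `G(A)` of an integral column vector. -/
def Coker.mk (A : Matrix ι ι ℤ) (x : ι → ℤ) : Coker A :=
  (LinearMap.range A.mulVecLin).mkQ x

/-- The torsion subgroup of `G(A)`. -/
abbrev Tor (A : Matrix ι ι ℤ) : Submodule ℤ (Coker A) := Submodule.torsion ℤ (Coker A)

/-- `b₁(A)`, the rank of the kernel of `A` on `ℤⁿ`. -/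
noncomputable def b₁ (A : Matrix ι ι ℤ) : ℕ := Module.finrank ℤ (LinearMap.ker A.mulVecLin)

/-- The rational matrix with the entries of `A`. -/
def toRat (A : Matrix ι ι ℤ) : Matrix ι ι ℚ := A.map (Int.cast : ℤ → ℚ)

/-- The rational column vector with the entries of `x`. -/
def vecRat (x : ι → ℤ) : ι → ℚ := fun i => (x i : ℚ)

/-- `u ∈ ℚⁿ` lifts the class `s ∈ G(A)`: `A u` is an integral vector representing `s`. -/
def IsLift (A : Matrix ι ι ℤ) (s : Coker A) (u : ι → ℚ) : Prop :=
  ∃ x : ι → ℤ, Coker.mk A x = s ∧ toRat A *ᵥ u = vecRat x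

theorem Coker.mk_eq_mk {A : Matrix ι ι ℤ} {x y : ι → ℤ} :
    Coker.mk A x = Coker.mk A y ↔ ∃ z : ι → ℤ, A *ᵥ z = x - y := by
  unfold Coker.mk
  rw [Submodule.mkQ_apply, Submodule.mkQ_apply, Submodule.Quotient.eq]
  simp [LinearMap.mem_range]

theorem toRat_mulVec (A : Matrix ι ι ℤ) (z : ι → ℤ) :
    toRat A *ᵥ vecRat z = vecRat (A *ᵥ z) := by
  ext i
  simp [toRat, vecRat, Matrix.mulVec, dotProduct]

theorem exists_isLift (A : Matrix ι ι ℤ) (s : Tor A) : ∃ u, IsLift A (s : Coker A) u := by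
  obtain ⟨s, hs⟩ := s
  obtain ⟨x, rfl⟩ := Submodule.mkQ_surjective _ s
  obtain ⟨a, ha⟩ := (Submodule.mem_torsion_iff _).1 hs
  have ha0 : ((a : ℤ) : ℚ) ≠ 0 := by exact_mod_cast nonZeroDivisors.coe_ne_zero a
  have h1 : Coker.mk A ((a : ℤ) • x) = Coker.mk A 0 := by
    have h2 : a • Coker.mk A x = 0 := ha
    rw [Submonoid.smul_def] at h2
    unfold Coker.mk at h2 ⊢
    rw [map_smul, map_zero, h2]
  obtain ⟨z, hz⟩ := Coker.mk_eq_mk.1 h1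
  refine ⟨((a : ℤ) : ℚ)⁻¹ • vecRat z, x, rfl, ?_⟩
  rw [Matrix.mulVec_smul, toRat_mulVec, hz]
  ext i
  simp [vecRat, ha0]

theorem IsLift.add {A : Matrix ι ι ℤ} {s t : Coker A} {u v : ι → ℚ}
    (hu : IsLift A s u) (hv : IsLift A t v) : IsLift A (s + t) (u + v) := by
  obtain ⟨x, rfl, hx⟩ := hu
  obtain ⟨y, rfl, hy⟩ := hv
  refine ⟨x + y, by simp [Coker.mk], ?_⟩
  rw [Matrix.mulVec_add, hx, hy]
  ext i
  simp [vecRat]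

theorem dotProduct_toRat_comm {A : Matrix ι ι ℤ} (hA : A.IsSymm) (u v : ι → ℚ) :
    u ⬝ᵥ (toRat A *ᵥ v) = v ⬝ᵥ (toRat A *ᵥ u) := by
  have h : (toRat A)ᵀ = toRat A := by
    unfold toRat
    rw [← Matrix.transpose_map, hA.eq]
  rw [Matrix.dotProduct_mulVec, ← Matrix.mulVec_transpose, h, dotProduct_comm]

theorem form_eq_of_isLift_right {A : Matrix ι ι ℤ} (hA : A.IsSymm) {s t : Coker A}
    {u v v' : ι → ℚ} (hu : IsLift A s u) (hv : IsLift A t v) (hv' : IsLift A t v') :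
    ((u ⬝ᵥ (toRat A *ᵥ v) : ℚ) : AddCircle (1 : ℚ)) = ((u ⬝ᵥ (toRat A *ᵥ v') : ℚ)) := by
  obtain ⟨x, -, hx⟩ := hu
  obtain ⟨y, rfl, hy⟩ := hv
  obtain ⟨y', hyy, hy'⟩ := hv'
  obtain ⟨z, hz⟩ := Coker.mk_eq_mk.1 hyy
  have h1 : vecRat y' = vecRat y + toRat A *ᵥ vecRat z := by
    rw [toRat_mulVec, hz]
    ext i
    simp [vecRat]
  rw [hy, hy', h1, dotProduct_add, dotProduct_toRat_comm hA, hx]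
  have h2 : vecRat z ⬝ᵥ vecRat x = ((z ⬝ᵥ x : ℤ) : ℚ) := by
    simp [vecRat, dotProduct]
  have h3 : (((z ⬝ᵥ x : ℤ) : ℚ) : AddCircle (1 : ℚ)) = 0 := by
    rw [AddCircle.coe_eq_zero_iff]
    exact ⟨z ⬝ᵥ x, by simp⟩
  rw [h2, AddCircle.coe_add, h3, add_zero]

theorem form_eq_of_isLift {A : Matrix ι ι ℤ} (hA : A.IsSymm) {s t : Coker A}
    {u u' v v' : ι → ℚ} (hu : IsLift A s u) (hu' : IsLift A s u')
    (hv : IsLift A t v) (hv' : IsLift A t v') :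
    ((u ⬝ᵥ (toRat A *ᵥ v) : ℚ) : AddCircle (1 : ℚ)) = ((u' ⬝ᵥ (toRat A *ᵥ v') : ℚ)) := by
  rw [form_eq_of_isLift_right hA hu hv hv', dotProduct_toRat_comm hA u v',
    form_eq_of_isLift_right hA hv' hu hu', dotProduct_toRat_comm hA v' u']

/-- The torsion linking pairing `λ_A : Tor G(A) × Tor G(A) → ℚ/ℤ` of a symmetric integral matrix:
`λ_A(s, t) = uᵀ A v mod ℤ` for any rational vectors `u`, `v` such that `A u`, `A v` are integral and
represent `s`, `t`. The value does not depend on `u`, `v`. If `det A ≠ 0` it is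
`λ_A([x], [y]) = xᵀ A⁻¹ y mod ℤ`; in general it is the pairing of the nonsingular block
of any splitting `Pᵀ A P = 0 ⊕ A_red`. Both facts are proved below. -/
noncomputable def linkingPairing (A : Matrix ι ι ℤ) (hA : A.IsSymm) :
    Tor A →+ Tor A →+ AddCircle (1 : ℚ) :=
  AddMonoidHom.mk'
    (fun s => AddMonoidHom.mk'
      (fun t => ((((exists_isLift A s).choose ⬝ᵥ
        (toRat A *ᵥ (exists_isLift A t).choose) : ℚ)) : AddCircle (1 : ℚ)))
      (fun t t' => by
        rw [← AddCircle.coe_add, ← dotProduct_add, ← Matrix.mulVec_add]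
        exact form_eq_of_isLift_right hA (exists_isLift A s).choose_spec
          (exists_isLift A (t + t')).choose_spec
          ((exists_isLift A t).choose_spec.add (exists_isLift A t').choose_spec)))
    (fun s s' => by
      ext t
      simp only [AddMonoidHom.mk'_apply, AddMonoidHom.add_apply]
      rw [← AddCircle.coe_add, ← add_dotProduct]
      exact form_eq_of_isLift hA (exists_isLift A (s + s')).choose_spec
        ((exists_isLift A s).choose_spec.add (exists_isLift A s').choose_spec)
        (exists_isLift A t).choose_spec (exists_isLift A t).choose_spec)

theorem linkingPairing_eq {A : Matrix ι ι ℤ} (hA : A.IsSymm) {s t : Tor A} {u v : ι → ℚ}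
    (hu : IsLift A (s : Coker A) u) (hv : IsLift A (t : Coker A) v) :
    linkingPairing A hA s t = ((u ⬝ᵥ (toRat A *ᵥ v) : ℚ) : AddCircle (1 : ℚ)) :=
  form_eq_of_isLift hA (exists_isLift A s).choose_spec hu (exists_isLift A t).choose_spec hv

/-- If `det A ≠ 0`, then `λ_A([x], [y]) = xᵀ A⁻¹ y mod ℤ`. -/
theorem linkingPairing_eq_inv [DecidableEq ι] {A : Matrix ι ι ℤ} (hA : A.IsSymm) (hdet : A.det ≠ 0)
    {s t : Tor A} {x y : ι → ℤ} (hx : Coker.mk A x = s) (hy : Coker.mk A y = t) :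
    linkingPairing A hA s t
      = ((vecRat x ⬝ᵥ ((toRat A)⁻¹ *ᵥ vecRat y) : ℚ) : AddCircle (1 : ℚ)) := by
  have hd : IsUnit (toRat A).det := by
    have h : (toRat A).det = (A.det : ℚ) := by
      simpa [toRat] using (Int.cast_det (R := ℚ) A).symm
    rw [h, isUnit_iff_ne_zero]
    exact_mod_cast hdet
  have key : ∀ z : ι → ℤ, toRat A *ᵥ ((toRat A)⁻¹ *ᵥ vecRat z) = vecRat z := fun z => by
    rw [Matrix.mulVec_mulVec, Matrix.mul_nonsing_inv _ hd, Matrix.one_mulVec]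
  rw [linkingPairing_eq hA ⟨x, hx, key x⟩ ⟨y, hy, key y⟩, dotProduct_toRat_comm hA, key,
    dotProduct_comm]

/-- If `Pᵀ A P = 0 ⊕ R` with `P` unimodular and `det R ≠ 0`, then `λ_A` is the pairing `λ_R`
transported along `[x] ↦ [R-component of Pᵀ x]`. -/
theorem linkingPairing_eq_reduced [DecidableEq ι] {α β : Type*} [Fintype α] [Fintype β] [DecidableEq β]
    {A : Matrix ι ι ℤ} (hA : A.IsSymm) {P : Matrix ι ι ℤ} (hP : IsUnit P.det)
    (e : ι ≃ α ⊕ β) {R : Matrix β β ℤ} (hR : R.det ≠ 0)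
    (h : Matrix.reindex e e (Pᵀ * A * P) = Matrix.fromBlocks 0 0 0 R)
    {s t : Tor A} {x y : ι → ℤ} (hx : Coker.mk A x = s) (hy : Coker.mk A y = t) :
    linkingPairing A hA s t
      = ((vecRat (fun b => (Pᵀ *ᵥ x) (e.symm (Sum.inr b))) ⬝ᵥ
          ((toRat R)⁻¹ *ᵥ vecRat (fun b => (Pᵀ *ᵥ y) (e.symm (Sum.inr b)))) : ℚ) :
            AddCircle (1 : ℚ)) := by
  have hPr : IsUnit (toRat P).det := by
    have h1 : (toRat P).det = (P.det : ℚ) := by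
      simpa [toRat] using (Int.cast_det (R := ℚ) P).symm
    rw [h1]
    exact hP.map (Int.castRingHom ℚ)
  have hRr : IsUnit (toRat R).det := by
    have h1 : (toRat R).det = (R.det : ℚ) := by
      simpa [toRat] using (Int.cast_det (R := ℚ) R).symm
    rw [h1, isUnit_iff_ne_zero]
    exact_mod_cast hR
  have hent : ∀ i j, ((toRat P)ᵀ * toRat A * toRat P) i j
      = ((Matrix.fromBlocks (0 : Matrix α α ℤ) 0 0 R (e i) (e j) : ℤ) : ℚ) := by
    intro i j
    rw [← h]
    simp [toRat, Matrix.mul_apply]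
  have hmul : ∀ (w : ι → ℚ) (b : β),
      (((toRat P)ᵀ * toRat A * toRat P) *ᵥ w) (e.symm (Sum.inr b))
        = (toRat R *ᵥ fun b => w (e.symm (Sum.inr b))) b := by
    intro w b
    simp only [Matrix.mulVec, dotProduct, hent]
    rw [← Equiv.sum_comp e.symm]
    simp [toRat]
  have hmul0 : ∀ (w : ι → ℚ) (a : α),
      (((toRat P)ᵀ * toRat A * toRat P) *ᵥ w) (e.symm (Sum.inl a)) = 0 := by
    intro w a
    simp only [Matrix.mulVec, dotProduct, hent]
    rw [← Equiv.sum_comp e.symm]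
    simp
  have hvec : ∀ z : ι → ℤ, (toRat P)ᵀ *ᵥ vecRat z = vecRat (Pᵀ *ᵥ z) := by
    intro z
    rw [← toRat_mulVec]
    rfl
  have main : ∀ (t : Tor A) (y : ι → ℤ), Coker.mk A y = t → ∃ w : ι → ℚ,
      IsLift A (t : Coker A) (toRat P *ᵥ w) ∧
      (fun b => w (e.symm (Sum.inr b))) =
        (toRat R)⁻¹ *ᵥ vecRat (fun b => (Pᵀ *ᵥ y) (e.symm (Sum.inr b))) := by
    intro t y hy
    obtain ⟨v, y', hy', hv⟩ := exists_isLift A t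
    obtain ⟨z, hz⟩ := Coker.mk_eq_mk.1 (hy.trans hy'.symm)
    have hv2 : toRat A *ᵥ (v + vecRat z) = vecRat y := by
      rw [Matrix.mulVec_add, hv, toRat_mulVec, hz]
      ext i
      simp [vecRat]
    have hw : toRat P *ᵥ ((toRat P)⁻¹ *ᵥ (v + vecRat z)) = v + vecRat z := by
      rw [Matrix.mulVec_mulVec, Matrix.mul_nonsing_inv _ hPr, Matrix.one_mulVec]
    refine ⟨(toRat P)⁻¹ *ᵥ (v + vecRat z), ⟨y, hy, by rw [hw, hv2]⟩, ?_⟩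
    have h3 : toRat R *ᵥ (fun b => ((toRat P)⁻¹ *ᵥ (v + vecRat z)) (e.symm (Sum.inr b)))
        = vecRat (fun b => (Pᵀ *ᵥ y) (e.symm (Sum.inr b))) := by
      ext b
      rw [← hmul, ← Matrix.mulVec_mulVec, ← Matrix.mulVec_mulVec, hw, hv2, hvec]
      rfl
    rw [← h3, Matrix.mulVec_mulVec, Matrix.nonsing_inv_mul _ hRr, Matrix.one_mulVec]
  obtain ⟨w, hw, hw2⟩ := main s x hx
  obtain ⟨w', hw', hw2'⟩ := main t y hy
  rw [linkingPairing_eq hA hw hw']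
  have h4 : (toRat P *ᵥ w) ⬝ᵥ (toRat A *ᵥ (toRat P *ᵥ w'))
      = w ⬝ᵥ (((toRat P)ᵀ * toRat A * toRat P) *ᵥ w') := by
    rw [← Matrix.mulVec_mulVec, ← Matrix.mulVec_mulVec, Matrix.dotProduct_mulVec w,
      Matrix.vecMul_transpose]
  have h5 : w ⬝ᵥ (((toRat P)ᵀ * toRat A * toRat P) *ᵥ w')
      = (fun b => w (e.symm (Sum.inr b))) ⬝ᵥ
        (toRat R *ᵥ fun b => w' (e.symm (Sum.inr b))) := by
    rw [dotProduct, ← Equiv.sum_comp e.symm, Fintype.sum_sum_type]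
    simp only [hmul, hmul0, mul_zero, Finset.sum_const_zero, zero_add]
    rfl
  have hRs : R.IsSymm := by
    have h6 : (Matrix.reindex e e (Pᵀ * A * P)).IsSymm := by
      have h7 : (Pᵀ * A * P).IsSymm := by
        unfold Matrix.IsSymm
        simp [Matrix.transpose_mul, hA.eq, Matrix.mul_assoc]
      exact h7.submatrix _
    rw [h] at h6
    ext i j
    exact congrFun (congrFun h6 (Sum.inr i)) (Sum.inr j)
  rw [h4, h5, dotProduct_toRat_comm hRs, hw2, Matrix.mulVec_mulVec,
    Matrix.mul_nonsing_inv _ hRr, Matrix.one_mulVec, dotProduct_comm, hw2']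

end Definitions
end Kirby

namespace Kirby
open Matrix

section Congruence

variable {R : Type*} [CommRing R]
variable {ι κ τ υ : Type*} [Fintype ι] [Fintype κ] [Fintype τ] [Fintype υ]
  [DecidableEq ι] [DecidableEq κ] [DecidableEq τ] [DecidableEq υ]

/-- Congruence of square matrices with possibly different index types. -/
def Cong (A : Matrix ι ι R) (B : Matrix κ κ R) : Prop :=
  ∃ (P : Matrix ι κ R) (Q : Matrix κ ι R), P * Q = 1 ∧ Q * P = 1 ∧ Pᵀ * A * P = B

/-- The orthogonal sum of two matrices. -/
abbrev osum (A : Matrix ι ι R) (B : Matrix κ κ R) : Matrix (ι ⊕ κ) (ι ⊕ κ) R :=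
  fromBlocks A 0 0 B

theorem Cong.refl (A : Matrix ι ι R) : Cong A A := ⟨1, 1, by simp, by simp, by simp⟩

theorem Cong.of_eq {A B : Matrix ι ι R} (h : A = B) : Cong A B := h ▸ Cong.refl A

theorem Cong.symm {A : Matrix ι ι R} {B : Matrix κ κ R} (h : Cong A B) : Cong B A := by
  obtain ⟨P, Q, h1, h2, rfl⟩ := h
  refine ⟨Q, P, h2, h1, ?_⟩
  have h3 : Qᵀ * Pᵀ = 1 := by rw [← transpose_mul, h1, transpose_one]
  calc Qᵀ * (Pᵀ * A * P) * Q = (Qᵀ * Pᵀ) * A * (P * Q) := by simp only [Matrix.mul_assoc]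
    _ = A := by rw [h3, h1]; simp

theorem Cong.trans {A : Matrix ι ι R} {B : Matrix κ κ R} {C : Matrix τ τ R}
    (h : Cong A B) (h' : Cong B C) : Cong A C := by
  obtain ⟨P, Q, h1, h2, rfl⟩ := h
  obtain ⟨P', Q', h1', h2', rfl⟩ := h'
  refine ⟨P * P', Q' * Q, ?_, ?_, ?_⟩
  · calc P * P' * (Q' * Q) = P * (P' * Q') * Q := by simp only [Matrix.mul_assoc]
      _ = 1 := by rw [h1', Matrix.mul_one, h1]
  · calc Q' * Q * (P * P') = Q' * (Q * P) * P' := by simp only [Matrix.mul_assoc]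
      _ = 1 := by rw [h2, Matrix.mul_one, h2']
  · simp only [transpose_mul, Matrix.mul_assoc]

theorem Cong.osum {A : Matrix ι ι R} {B : Matrix κ κ R} {C : Matrix τ τ R} {D : Matrix υ υ R}
    (h : Cong A B) (h' : Cong C D) : Cong (osum A C) (osum B D) := by
  obtain ⟨P, Q, h1, h2, rfl⟩ := h
  obtain ⟨P', Q', h1', h2', rfl⟩ := h'
  refine ⟨fromBlocks P 0 0 P', fromBlocks Q 0 0 Q', ?_, ?_, ?_⟩ <;>
    simp [fromBlocks_multiply, fromBlocks_transpose, *]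

theorem Cong.submatrix (A : Matrix ι ι R) (e : κ ≃ ι) : Cong A (A.submatrix e e) := by
  refine ⟨(1 : Matrix ι ι R).submatrix id e, (1 : Matrix ι ι R).submatrix e id, ?_, ?_, ?_⟩
  · rw [submatrix_mul_equiv]; simp
  · rw [← submatrix_mul _ _ e id e Function.bijective_id, Matrix.mul_one, submatrix_one_equiv]
  · rw [transpose_submatrix, transpose_one]
    rw [show A = A.submatrix id id from rfl,
      ← submatrix_mul _ _ e id id Function.bijective_id,
      ← submatrix_mul _ _ e id e Function.bijective_id]
    simp

theorem osum_comm (A : Matrix ι ι R) (B : Matrix κ κ R) : Cong (osum A B) (osum B A) := by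
  convert Cong.submatrix (osum A B) (Equiv.sumComm κ ι) using 1
  ext (i | i) (j | j) <;> simp

theorem osum_assoc (A : Matrix ι ι R) (B : Matrix κ κ R) (C : Matrix τ τ R) :
    Cong (osum (osum A B) C) (osum A (osum B C)) := by
  convert Cong.submatrix (osum (osum A B) C) (Equiv.sumAssoc ι κ τ).symm using 1
  ext (i | i | i) (j | j | j) <;> simp

theorem osum_empty [IsEmpty κ] (A : Matrix ι ι R) (B : Matrix κ κ R) : Cong (osum A B) A := by
  convert Cong.submatrix (osum A B) (Equiv.sumEmpty ι κ).symm using 1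
  ext i j
  simp

theorem Cong.card_eq [Nontrivial R] {A : Matrix ι ι R} {B : Matrix κ κ R} (h : Cong A B) :
    Fintype.card ι = Fintype.card κ := by
  obtain ⟨P, Q, h1, h2, -⟩ := h
  refine card_eq_of_linearEquiv R (LinearEquiv.ofLinearMap Q.mulVecLin P.mulVecLin ?_ ?_)
  · rw [← Matrix.mulVecLin_mul, h2, Matrix.mulVecLin_one]
  · rw [← Matrix.mulVecLin_mul, h1, Matrix.mulVecLin_one]

theorem Cong.isSymm {A : Matrix ι ι R} {B : Matrix κ κ R} (h : Cong A B) (hA : A.IsSymm) :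
    B.IsSymm := by
  obtain ⟨P, Q, -, -, rfl⟩ := h
  simp [Matrix.IsSymm, transpose_mul, hA.eq, Matrix.mul_assoc]

/-- The diagonal matrix `I_r ⊕ (-I_s)`. -/
def sgn (R : Type*) [CommRing R] (r s : ℕ) : Matrix (Fin r ⊕ Fin s) (Fin r ⊕ Fin s) R :=
  fromBlocks 1 0 0 (-1)

theorem osum_osum_osum_comm (A : Matrix ι ι R) (B : Matrix κ κ R) (C : Matrix τ τ R)
    (D : Matrix υ υ R) : Cong (osum (osum A B) (osum C D)) (osum (osum A C) (osum B D)) := by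
  convert Cong.submatrix (osum (osum A B) (osum C D)) (Equiv.sumSumSumComm ι τ κ υ) using 1
  ext ((i | i) | (i | i)) ((j | j) | (j | j)) <;> simp

theorem sgn_add (r s r' s' : ℕ) :
    Cong (osum (sgn R r s) (sgn R r' s')) (sgn R (r + r') (s + s')) := by
  refine (osum_osum_osum_comm _ _ _ _).trans ?_
  refine Cong.osum ?_ ?_
  · convert Cong.submatrix (osum (1 : Matrix (Fin r) (Fin r) R) (1 : Matrix (Fin r') (Fin r') R))
      finSumFinEquiv.symm using 1
    rw [osum, fromBlocks_one, submatrix_one_equiv]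
  · convert Cong.submatrix (osum (-1 : Matrix (Fin s) (Fin s) R) (-1 : Matrix (Fin s') (Fin s') R))
      finSumFinEquiv.symm using 1
    have : osum (-1 : Matrix (Fin s) (Fin s) R) (-1 : Matrix (Fin s') (Fin s') R) = -1 := by
      rw [osum, ← fromBlocks_one, fromBlocks_neg]; simp
    rw [this, submatrix_neg, Pi.neg_apply, Pi.neg_apply, submatrix_one_equiv]

/-- Stable congruence: congruence after adding diagonal matrices with entries `±1`. -/
def Stab (A : Matrix ι ι R) (B : Matrix κ κ R) : Prop :=
  ∃ r s r' s' : ℕ, Cong (osum A (sgn R r s)) (osum B (sgn R r' s'))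

theorem Cong.stab {A : Matrix ι ι R} {B : Matrix κ κ R} (h : Cong A B) : Stab A B :=
  ⟨0, 0, 0, 0, h.osum (Cong.refl _)⟩

theorem Stab.refl (A : Matrix ι ι R) : Stab A A := (Cong.refl A).stab

theorem Stab.symm {A : Matrix ι ι R} {B : Matrix κ κ R} (h : Stab A B) : Stab B A := by
  obtain ⟨r, s, r', s', h⟩ := h
  exact ⟨r', s', r, s, h.symm⟩

theorem osum_sgn_add (A : Matrix ι ι R) (r s r' s' : ℕ) :
    Cong (osum (osum A (sgn R r s)) (sgn R r' s')) (osum A (sgn R (r + r') (s + s'))) :=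
  (osum_assoc _ _ _).trans ((Cong.refl A).osum (sgn_add r s r' s'))

theorem Stab.trans {A : Matrix ι ι R} {B : Matrix κ κ R} {C : Matrix τ τ R}
    (h : Stab A B) (h' : Stab B C) : Stab A C := by
  obtain ⟨r, s, r', s', h⟩ := h
  obtain ⟨p, q, p', q', h'⟩ := h'
  refine ⟨r + p, s + q, p' + r', q' + s', ?_⟩
  refine (osum_sgn_add A r s p q).symm.trans ((h.osum (Cong.refl _)).trans ?_)
  refine (osum_sgn_add B r' s' p q).trans ?_
  rw [add_comm r', add_comm s']
  exact (osum_sgn_add B p q r' s').symm.trans ((h'.osum (Cong.refl _)).trans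
    (osum_sgn_add C p' q' r' s'))

theorem Stab.osum {A : Matrix ι ι R} {B : Matrix κ κ R} {C : Matrix τ τ R} {D : Matrix υ υ R}
    (h : Stab A B) (h' : Stab C D) : Stab (osum A C) (osum B D) := by
  obtain ⟨r, s, r', s', h⟩ := h
  obtain ⟨p, q, p', q', h'⟩ := h'
  refine ⟨r + p, s + q, r' + p', s' + q', ?_⟩
  refine ((Cong.refl _).osum (sgn_add r s p q).symm).trans ?_
  refine (osum_osum_osum_comm _ _ _ _).trans ?_
  refine (h.osum h').trans ?_
  exact (osum_osum_osum_comm _ _ _ _).trans ((Cong.refl _).osum (sgn_add _ _ _ _))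

theorem stab_sgn (A : Matrix ι ι R) (r s : ℕ) : Stab (Kirby.osum A (sgn R r s)) A :=
  ⟨0, 0, r, s, osum_empty _ _⟩

end Congruence

theorem stablyCongruent_iff {n m : ℕ} (A : Matrix (Fin n) (Fin n) ℤ)
    (A' : Matrix (Fin m) (Fin m) ℤ) : StablyCongruent A A' ↔ Stab A A' := by
  constructor
  · rintro ⟨r, s, r', s', e, P, hP, h⟩
    refine ⟨r, s, r', s', ?_⟩
    change Cong (stabilize A r s) (stabilize A' r' s')
    rw [← h, reindex_apply]
    refine Cong.trans ?_ (Cong.submatrix _ e.symm)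
    exact ⟨P, P⁻¹, mul_nonsing_inv _ hP, nonsing_inv_mul _ hP, rfl⟩
  · rintro ⟨r, s, r', s', h⟩
    have hc := h.card_eq
    obtain ⟨P, Q, h1, h2, h3⟩ := h
    let e := Fintype.equivOfCardEq hc
    refine ⟨r, s, r', s', e, P.submatrix id e, ?_, ?_⟩
    · refine (Matrix.isUnit_iff_isUnit_det _).1 (IsUnit.of_mul_eq_one (Q.submatrix e id) ?_)
      rw [submatrix_mul_equiv, h1, submatrix_id_id]
    · change _ = osum A' (sgn ℤ r' s')
      rw [← h3]
      ext i j
      simp [Matrix.mul_apply, stabilize, sgn, osum]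

section Linking

variable {ι κ τ : Type*} [Fintype ι] [Fintype κ] [Fintype τ]

/-- Isometry of the torsion linking pairings. -/
def LinkEq (A : Matrix ι ι ℤ) (hA : A.IsSymm) (B : Matrix κ κ ℤ) (hB : B.IsSymm) : Prop :=
  ∃ φ : Tor A ≃+ Tor B, ∀ s t : Tor A,
    linkingPairing B hB (φ s) (φ t) = linkingPairing A hA s t

theorem LinkEq.symm {A : Matrix ι ι ℤ} {hA : A.IsSymm} {B : Matrix κ κ ℤ} {hB : B.IsSymm}
    (h : LinkEq A hA B hB) : LinkEq B hB A hA := by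
  obtain ⟨φ, h⟩ := h
  exact ⟨φ.symm, fun s t => by rw [← h]; simp⟩

theorem LinkEq.trans {A : Matrix ι ι ℤ} {hA : A.IsSymm} {B : Matrix κ κ ℤ} {hB : B.IsSymm}
    {C : Matrix τ τ ℤ} {hC : C.IsSymm}
    (h : LinkEq A hA B hB) (h' : LinkEq B hB C hC) : LinkEq A hA C hC := by
  obtain ⟨φ, h⟩ := h
  obtain ⟨ψ, h'⟩ := h'
  exact ⟨φ.trans ψ, fun s t => by simp [h, h']⟩

theorem Coker.mk_mem_torsion {A : Matrix ι ι ℤ} {x : ι → ℤ} {u : ι → ℚ}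
    (h : toRat A *ᵥ u = vecRat x) : Coker.mk A x ∈ Submodule.torsion ℤ (Coker A) := by
  obtain ⟨d, hd⟩ := IsLocalization.exist_integer_multiples_of_finset (nonZeroDivisors ℤ)
    (Finset.univ.image u)
  have hz : ∀ i, ∃ z : ℤ, (z : ℚ) = (d : ℤ) * u i := by
    intro i
    obtain ⟨z, hz⟩ := hd (u i) (Finset.mem_image_of_mem _ (Finset.mem_univ _))
    exact ⟨z, by simpa using hz⟩
  choose z hz using hz
  rw [Submodule.mem_torsion_iff]
  refine ⟨d, ?_⟩
  have h1 : A *ᵥ z = (d : ℤ) • x := by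
    have h2 : vecRat (A *ᵥ z) = vecRat ((d : ℤ) • x) := by
      rw [← toRat_mulVec]
      have : vecRat z = ((d : ℤ) : ℚ) • u := by ext i; simp [vecRat, hz]
      rw [this, mulVec_smul, h]
      ext i
      simp [vecRat]
    ext i
    have := congrFun h2 i
    simp only [vecRat] at this
    exact_mod_cast this
  have h3 : Coker.mk A ((d : ℤ) • x) = Coker.mk A 0 :=
    Coker.mk_eq_mk.2 ⟨z, by rw [h1, sub_zero]⟩
  rw [Submonoid.smul_def]
  unfold Coker.mk at h3 ⊢
  rwa [map_smul, map_zero] at h3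

/-- The rational matrix with the entries of a rectangular integral matrix. -/
def castQ {ι κ : Type*} (A : Matrix ι κ ℤ) : Matrix ι κ ℚ := A.map (Int.castRingHom ℚ)

omit [Fintype ι] in
theorem toRat_eq_castQ (A : Matrix ι ι ℤ) : toRat A = castQ A := rfl

theorem castQ_mul {ι κ τ : Type*} [Fintype κ] (A : Matrix ι κ ℤ) (B : Matrix κ τ ℤ) :
    castQ (A * B) = castQ A * castQ B :=
  Matrix.map_mul

theorem castQ_transpose {ι κ : Type*} (A : Matrix ι κ ℤ) : castQ Aᵀ = (castQ A)ᵀ := rfl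

omit [Fintype κ] in
theorem castQ_mulVec_vecRat (A : Matrix κ ι ℤ) (x : ι → ℤ) :
    castQ A *ᵥ vecRat x = vecRat (A *ᵥ x) := by
  ext i
  simp [castQ, vecRat, Matrix.mulVec, dotProduct]

/-- The homomorphism `Tor G(A) → Tor G(B)` induced by a matrix `F` with `F A = B K`. -/
noncomputable def torMap {A : Matrix ι ι ℤ} {B : Matrix κ κ ℤ} (F K : Matrix κ ι ℤ)
    (h : F * A = B * K) : Tor A →ₗ[ℤ] Tor B :=
  (Submodule.mapQ (LinearMap.range A.mulVecLin) (LinearMap.range B.mulVecLin) F.mulVecLin (by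
    rintro _ ⟨z, rfl⟩
    refine ⟨K *ᵥ z, ?_⟩
    simp [h])).restrict (by
    intro x hx
    obtain ⟨a, ha⟩ := (Submodule.mem_torsion_iff _).1 hx
    exact (Submodule.mem_torsion_iff _).2 ⟨a, by
      rw [Submonoid.smul_def] at ha ⊢
      rw [← map_smul, ha, map_zero]⟩)

theorem torMap_coe {A : Matrix ι ι ℤ} {B : Matrix κ κ ℤ} (F K : Matrix κ ι ℤ)
    (h : F * A = B * K) (s : Tor A) {x : ι → ℤ} (hx : Coker.mk A x = s) :
    ((torMap F K h s : Tor B) : Coker B) = Coker.mk B (F *ᵥ x) := by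
  simp [torMap, LinearMap.restrict_apply, ← hx, Coker.mk]

theorem torMap_torMap {A : Matrix ι ι ℤ} {B : Matrix κ κ ℤ} {F K : Matrix κ ι ℤ}
    {F' K' : Matrix ι κ ℤ} (h : F * A = B * K) (h' : F' * B = A * K')
    (h3 : ∀ (x : ι → ℤ) (u : ι → ℚ), toRat A *ᵥ u = vecRat x →
      ∃ z, A *ᵥ z = F' *ᵥ (F *ᵥ x) - x) (s : Tor A) :
    torMap F' K' h' (torMap F K h s) = s := by
  obtain ⟨u, x, hx, hu⟩ := exists_isLift A s
  apply Subtype.ext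
  rw [torMap_coe F' K' h' _ (torMap_coe F K h s hx).symm, ← hx]
  exact Coker.mk_eq_mk.2 (h3 x u hu)

theorem linkEq_of_matrices {A : Matrix ι ι ℤ} (hA : A.IsSymm) {B : Matrix κ κ ℤ} (hB : B.IsSymm)
    {F K : Matrix κ ι ℤ} {F' K' : Matrix ι κ ℤ} (h : F * A = B * K) (h' : F' * B = A * K')
    (h2 : Kᵀ * B * K = A)
    (h3 : ∀ (x : ι → ℤ) (u : ι → ℚ), toRat A *ᵥ u = vecRat x →
      ∃ z, A *ᵥ z = F' *ᵥ (F *ᵥ x) - x)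
    (h4 : ∀ (x : κ → ℤ) (u : κ → ℚ), toRat B *ᵥ u = vecRat x →
      ∃ z, B *ᵥ z = F *ᵥ (F' *ᵥ x) - x) : LinkEq A hA B hB := by
  refine ⟨{ toFun := torMap F K h
            invFun := torMap F' K' h'
            left_inv := torMap_torMap h h' h3
            right_inv := torMap_torMap h' h h4
            map_add' := map_add _ }, fun s t => ?_⟩
  obtain ⟨u, x, hx, hu⟩ := exists_isLift A s
  obtain ⟨v, y, hy, hv⟩ := exists_isLift A t
  change linkingPairing B hB (torMap F K h s) (torMap F K h t) = _
  have key : ∀ (x : ι → ℤ) (u : ι → ℚ), toRat A *ᵥ u = vecRat x →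
      toRat B *ᵥ (castQ K *ᵥ u) = vecRat (F *ᵥ x) := by
    intro x u hu
    have h5 : castQ B * castQ K = castQ F * castQ A := by
      rw [← castQ_mul F A, h, castQ_mul]
    rw [mulVec_mulVec, toRat_eq_castQ, h5, ← mulVec_mulVec, ← toRat_eq_castQ, hu,
      castQ_mulVec_vecRat]
  rw [linkingPairing_eq hA ⟨x, hx, hu⟩ ⟨y, hy, hv⟩,
    linkingPairing_eq hB ⟨F *ᵥ x, (torMap_coe F K h s hx).symm, key x u hu⟩
      ⟨F *ᵥ y, (torMap_coe F K h t hy).symm, key y v hv⟩]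
  congr 1
  have h5 : toRat A = (castQ K)ᵀ * toRat B * castQ K := by
    rw [toRat_eq_castQ, toRat_eq_castQ, ← castQ_transpose, ← castQ_mul, ← castQ_mul, h2]
  rw [h5, ← mulVec_mulVec, ← mulVec_mulVec, Matrix.dotProduct_mulVec u, vecMul_transpose]

variable [DecidableEq ι] [DecidableEq κ]

theorem Cong.linkEq {A : Matrix ι ι ℤ} (hA : A.IsSymm) {B : Matrix κ κ ℤ} (hB : B.IsSymm)
    (h : Cong A B) : LinkEq A hA B hB := by
  obtain ⟨P, Q, h1, h2, h3⟩ := h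
  have h1' : Qᵀ * Pᵀ = 1 := by rw [← transpose_mul, h1, transpose_one]
  have h2' : Pᵀ * Qᵀ = 1 := by rw [← transpose_mul, h2, transpose_one]
  refine linkEq_of_matrices hA hB (F := Pᵀ) (K := Q) (F' := Qᵀ) (K' := P) ?_ ?_ ?_ ?_ ?_
  · rw [← h3, Matrix.mul_assoc, h1, Matrix.mul_one]
  · rw [← h3, Matrix.mul_assoc, ← Matrix.mul_assoc, h1', Matrix.one_mul]
  · calc Qᵀ * B * Q = (Qᵀ * Pᵀ) * A * (P * Q) := by rw [← h3]; simp only [Matrix.mul_assoc]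
      _ = A := by rw [h1', h1]; simp
  · intro x u _
    exact ⟨0, by rw [mulVec_mulVec, h1']; simp⟩
  · intro x u _
    exact ⟨0, by rw [mulVec_mulVec, h2']; simp⟩

theorem linkEq_osum_unimodular {A : Matrix ι ι ℤ} (hA : A.IsSymm) {D : Matrix κ κ ℤ}
    (hAD : (osum A D).IsSymm) (hD : IsUnit D.det) : LinkEq A hA (osum A D) hAD := by
  refine linkEq_of_matrices hA hAD (F := fromRows 1 0) (K := fromRows 1 0)
    (F' := fromCols 1 0) (K' := fromCols 1 0) ?_ ?_ ?_ ?_ ?_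
  · rw [osum, fromBlocks_mul_fromRows, fromRows_mul]; simp
  · rw [osum, fromCols_mul_fromBlocks, mul_fromCols]; simp
  · rw [osum, transpose_fromRows, fromCols_mul_fromBlocks, fromCols_mul_fromRows]; simp
  · intro x u _
    exact ⟨0, by rw [mulVec_mulVec, fromCols_mul_fromRows]; simp⟩
  · intro x u _
    refine ⟨Sum.elim 0 (-(D⁻¹ *ᵥ (x ∘ Sum.inr))), ?_⟩
    rw [osum, fromBlocks_mulVec]
    ext (i | i)
    · simp [fromRows_mulVec, fromCols_mulVec]
    · simp [fromRows_mulVec, fromCols_mulVec, mulVec_neg, mul_nonsing_inv _ hD]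

omit [DecidableEq ι] in
theorem linkEq_zero_osum {R : Matrix κ κ ℤ} (hR : R.IsSymm)
    (h0R : (osum (0 : Matrix ι ι ℤ) R).IsSymm) : LinkEq R hR (osum (0 : Matrix ι ι ℤ) R) h0R := by
  refine linkEq_of_matrices hR h0R (F := fromRows 0 1) (K := fromRows 0 1)
    (F' := fromCols 0 1) (K' := fromCols 0 1) ?_ ?_ ?_ ?_ ?_
  · rw [osum, fromBlocks_mul_fromRows, fromRows_mul]; simp
  · rw [osum, fromCols_mul_fromBlocks, mul_fromCols]; simp
  · rw [osum, transpose_fromRows, fromCols_mul_fromBlocks, fromCols_mul_fromRows]; simp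
  · intro x u _
    exact ⟨0, by rw [mulVec_mulVec, fromCols_mul_fromRows]; simp⟩
  · intro x u hu
    refine ⟨0, ?_⟩
    ext (i | i)
    · have := congrFun hu (Sum.inl i)
      simp only [toRat, osum, fromBlocks_map, fromBlocks_mulVec, vecRat] at this
      have h0 : (0 : Matrix ι ι ℤ).map (Int.cast : ℤ → ℚ) = 0 := by ext; simp
      have h0' : (0 : Matrix ι κ ℤ).map (Int.cast : ℤ → ℚ) = 0 := by ext; simp
      rw [h0, h0'] at this
      have h1 : x (Sum.inl i) = 0 := by simpa using this.symm
      simp [fromRows_mulVec, h1]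
    · simp [fromRows_mulVec, fromCols_mulVec]

omit [DecidableEq ι] [DecidableEq κ] in
theorem b₁_eq_of_matrices {A : Matrix ι ι ℤ} {B : Matrix κ κ ℤ} (K : Matrix κ ι ℤ)
    (L : Matrix ι κ ℤ) (h1 : ∀ x, A *ᵥ x = 0 → B *ᵥ (K *ᵥ x) = 0)
    (h2 : ∀ y, B *ᵥ y = 0 → A *ᵥ (L *ᵥ y) = 0) (h3 : ∀ x, A *ᵥ x = 0 → L *ᵥ (K *ᵥ x) = x)
    (h4 : ∀ y, B *ᵥ y = 0 → K *ᵥ (L *ᵥ y) = y) : b₁ A = b₁ B := by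
  refine LinearEquiv.finrank_eq (LinearEquiv.ofLinearMap
    (K.mulVecLin.restrict (p := LinearMap.ker A.mulVecLin) (q := LinearMap.ker B.mulVecLin)
      fun x hx => by simpa using h1 x (by simpa using hx))
    (L.mulVecLin.restrict (p := LinearMap.ker B.mulVecLin) (q := LinearMap.ker A.mulVecLin)
      fun x hx => by simpa using h2 x (by simpa using hx)) ?_ ?_)
  · ext1 y
    apply Subtype.ext
    simpa [LinearMap.restrict_apply] using h4 y (LinearMap.mem_ker.1 y.2)
  · ext1 x
    apply Subtype.ext
    simpa [LinearMap.restrict_apply] using h3 x (LinearMap.mem_ker.1 x.2)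

theorem Cong.b₁_eq {A : Matrix ι ι ℤ} {B : Matrix κ κ ℤ} (h : Cong A B) : b₁ A = b₁ B := by
  obtain ⟨P, Q, h1, h2, h3⟩ := h
  have h1' : Qᵀ * Pᵀ = 1 := by rw [← transpose_mul, h1, transpose_one]
  refine b₁_eq_of_matrices Q P ?_ ?_ ?_ ?_
  · intro x hx
    rw [mulVec_mulVec, ← h3, Matrix.mul_assoc, h1, Matrix.mul_one, ← mulVec_mulVec, hx, mulVec_zero]
  · intro y hy
    calc A *ᵥ (P *ᵥ y) = Qᵀ *ᵥ ((Pᵀ * A * P) *ᵥ y) := by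
          rw [mulVec_mulVec, mulVec_mulVec, ← Matrix.mul_assoc, ← Matrix.mul_assoc, h1',
            Matrix.one_mul]
      _ = 0 := by rw [h3, hy, mulVec_zero]
  · intro x _
    rw [mulVec_mulVec, h1, one_mulVec]
  · intro x _
    rw [mulVec_mulVec, h2, one_mulVec]

theorem b₁_osum {A : Matrix ι ι ℤ} {D : Matrix κ κ ℤ} (hD : D.det ≠ 0) :
    b₁ (osum A D) = b₁ A := by
  have key : ∀ y, osum A D *ᵥ y = 0 → A *ᵥ (y ∘ Sum.inl) = 0 ∧ y ∘ Sum.inr = 0 := by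
    intro y hy
    rw [osum, fromBlocks_mulVec] at hy
    constructor
    · ext i
      simpa using congrFun hy (Sum.inl i)
    · refine eq_zero_of_mulVec_eq_zero hD ?_
      ext i
      simpa using congrFun hy (Sum.inr i)
  refine b₁_eq_of_matrices (fromCols 1 0) (fromRows 1 0) ?_ ?_ ?_ ?_
  · intro y hy
    rw [fromCols_mulVec]
    simpa using (key y hy).1
  · intro x hx
    rw [osum, fromBlocks_mulVec]
    ext (i | i) <;> simp [fromRows_mulVec, hx]
  · intro y hy
    ext (i | i)
    · simp [fromRows_mulVec, fromCols_mulVec]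
    · have : y (Sum.inr i) = 0 := congrFun (key y hy).2 i
      simp [fromRows_mulVec, this]
  · intro y _
    rw [mulVec_mulVec, fromCols_mul_fromRows]
    simp

omit [DecidableEq ι] in
theorem b₁_zero : b₁ (0 : Matrix ι ι ℤ) = Fintype.card ι := by
  unfold b₁
  have : LinearMap.ker (0 : Matrix ι ι ℤ).mulVecLin = ⊤ := by
    ext; simp
  rw [this, finrank_top, Module.finrank_fintype_fun_eq_card]

theorem isSymm_sgn (r s : ℕ) : (sgn ℤ r s).IsSymm := by
  simp [Matrix.IsSymm, sgn, fromBlocks_transpose]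

theorem isUnit_det_sgn {R : Type*} [CommRing R] (r s : ℕ) : IsUnit (sgn R r s).det := by
  rw [sgn, det_fromBlocks_zero₂₁, det_one, one_mul, det_neg, det_one, mul_one]
  exact isUnit_one.neg.pow _

omit [Fintype ι] [Fintype κ] [DecidableEq ι] [DecidableEq κ] in
theorem isSymm_osum {A : Matrix ι ι ℤ} {B : Matrix κ κ ℤ} (hA : A.IsSymm) (hB : B.IsSymm) :
    (osum A B).IsSymm := by
  rw [Matrix.IsSymm, Kirby.osum, fromBlocks_transpose, hA.eq, hB.eq]; simp

theorem Stab.b₁_eq_and_linkEq {A : Matrix ι ι ℤ} (hA : A.IsSymm) {B : Matrix κ κ ℤ}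
    (hB : B.IsSymm) (h : Stab A B) : b₁ A = b₁ B ∧ LinkEq A hA B hB := by
  obtain ⟨r, s, r', s', h⟩ := h
  constructor
  · rw [← b₁_osum (isUnit_det_sgn r s).ne_zero, h.b₁_eq, b₁_osum (isUnit_det_sgn r' s').ne_zero]
  · exact (linkEq_osum_unimodular hA (isSymm_osum hA (isSymm_sgn r s)) (isUnit_det_sgn r s)).trans
      ((h.linkEq _ _).trans
        (linkEq_osum_unimodular hB (isSymm_osum hB (isSymm_sgn r' s')) (isUnit_det_sgn r' s')).symm)

end Linking
section Splitting

variable {ι : Type*} [Fintype ι] [DecidableEq ι]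

/-- A saturated submodule of `ℤⁿ` is spanned by a part of a basis. -/
theorem exists_matrix_of_saturated (S : Submodule ℤ (ι → ℤ))
    (hS : ∀ (n : ℤ) (y : ι → ℤ), n ≠ 0 → n • y ∈ S → y ∈ S) :
    ∃ (l : ℕ) (P : Matrix ι (Fin (Module.finrank ℤ S) ⊕ Fin l) ℤ)
      (Q : Matrix (Fin (Module.finrank ℤ S) ⊕ Fin l) ι ℤ),
      P * Q = 1 ∧ Q * P = 1 ∧ ∀ y, y ∈ S ↔ ∀ j, (Q *ᵥ y) (Sum.inr j) = 0 := by
  have : Module.IsTorsionFree ℤ ((ι → ℤ) ⧸ S) := by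
    refine Module.IsTorsionFree.of_smul_eq_zero fun n m h => ?_
    obtain ⟨y, rfl⟩ := S.mkQ_surjective m
    by_cases hn : n = 0
    · exact Or.inl hn
    · right
      rw [← map_smul, Submodule.mkQ_apply, Submodule.Quotient.mk_eq_zero] at h
      rw [Submodule.mkQ_apply, Submodule.Quotient.mk_eq_zero]
      exact hS n y hn h
  let bS := Module.finBasis ℤ S
  let bQ := Module.finBasis ℤ ((ι → ℤ) ⧸ S)
  let b := bS.sumQuot bQ
  let c := Pi.basisFun ℤ ι
  refine ⟨_, c.toMatrix b, b.toMatrix c, ?_, ?_, fun y => ?_⟩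
  · rw [Module.Basis.toMatrix_mul_toMatrix, Module.Basis.toMatrix_self]
  · rw [Module.Basis.toMatrix_mul_toMatrix, Module.Basis.toMatrix_self]
  · have hrep : b.toMatrix c *ᵥ y = b.repr y := by
      rw [← Module.Basis.toMatrix_mulVec_repr c b y]
      congr 1
    rw [hrep]
    have hsum : y = ∑ i, b.repr y (Sum.inl i) • (bS i : ι → ℤ) +
        ∑ j, b.repr y (Sum.inr j) • b (Sum.inr j) := by
      conv_lhs => rw [← b.sum_repr y, Fintype.sum_sum_type]
      simp [b, Module.Basis.sumQuot_inl]
    have hmem : ∑ i, b.repr y (Sum.inl i) • (bS i : ι → ℤ) ∈ S :=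
      Submodule.sum_mem _ fun i _ => S.smul_mem _ (bS i).2
    constructor
    · intro hy
      have h0 : S.mkQ (∑ j, b.repr y (Sum.inr j) • b (Sum.inr j)) = 0 := by
        rw [Submodule.mkQ_apply, Submodule.Quotient.mk_eq_zero]
        rw [hsum] at hy
        exact (Submodule.add_mem_iff_right _ hmem).1 hy
      rw [map_sum] at h0
      have h1 : ∑ j, b.repr y (Sum.inr j) • bQ j = 0 := by
        rw [← h0]
        refine Finset.sum_congr rfl fun j _ => ?_
        rw [map_smul]
        congr 1
        exact (Module.Basis.sumQuot_inr bS bQ j).symm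
      exact Fintype.linearIndependent_iff.1 bQ.linearIndependent _ h1
    · intro h
      rw [hsum]
      refine add_mem hmem ?_
      simp [h]

theorem exists_cong_zero_osum {A : Matrix ι ι ℤ} (hA : A.IsSymm) :
    ∃ (k l : ℕ) (R : Matrix (Fin l) (Fin l) ℤ), R.IsSymm ∧ R.det ≠ 0 ∧
      Cong A (osum (0 : Matrix (Fin k) (Fin k) ℤ) R) := by
  obtain ⟨l, P, Q, h1, h2, h3⟩ := exists_matrix_of_saturated (LinearMap.ker A.mulVecLin) (by
    intro n y hn hy
    rw [LinearMap.mem_ker, map_smul] at hy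
    exact (smul_eq_zero.1 hy).resolve_left hn)
  simp only [LinearMap.mem_ker, mulVecLin_apply] at h3
  have hB : Cong A (Pᵀ * A * P) := ⟨P, Q, h1, h2, rfl⟩
  have hBs := hB.isSymm hA
  have hcol : ∀ i j, (Pᵀ * A * P) i (Sum.inl j) = 0 := by
    intro i j
    have h4 : A *ᵥ (P *ᵥ Pi.single (Sum.inl j) 1) = 0 := by
      rw [h3]
      intro j'
      rw [mulVec_mulVec, h2]
      simp
    have h5 : (Pᵀ * A * P) *ᵥ Pi.single (Sum.inl j) 1 = 0 := by
      rw [← mulVec_mulVec, ← mulVec_mulVec, h4, mulVec_zero]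
    simpa using congrFun h5 i
  have hrow : ∀ i j, (Pᵀ * A * P) (Sum.inl i) j = 0 := fun i j => by
    rw [← hBs.apply]; exact hcol _ _
  have hBB : Pᵀ * A * P = osum 0 (Pᵀ * A * P).toBlocks₂₂ := by
    ext (i | i) (j | j)
    · simp [hcol]
    · simp [hrow]
    · simp [hcol]
    · simp [toBlocks₂₂]
  refine ⟨_, l, (Pᵀ * A * P).toBlocks₂₂, ?_, ?_, hBB ▸ hB⟩
  · ext i j
    exact hBs.apply _ _
  · intro hdet
    obtain ⟨v, hv, hRv⟩ := exists_mulVec_eq_zero_iff.2 hdet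
    refine hv (funext fun j => ?_)
    have h6 : (Pᵀ * A * P) *ᵥ Sum.elim 0 v = 0 := by
      rw [hBB, osum, fromBlocks_mulVec]
      ext (i | i) <;> simp [hRv]
    have h7 : A *ᵥ (P *ᵥ Sum.elim 0 v) = 0 := by
      calc A *ᵥ (P *ᵥ Sum.elim 0 v) = Qᵀ *ᵥ ((Pᵀ * A * P) *ᵥ Sum.elim 0 v) := by
            rw [mulVec_mulVec, mulVec_mulVec, ← Matrix.mul_assoc, ← Matrix.mul_assoc,
              ← transpose_mul, h1, transpose_one, Matrix.one_mul]
        _ = 0 := by rw [h6, mulVec_zero]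
    have h8 := (h3 _).1 h7 j
    rw [mulVec_mulVec, h2] at h8
    simpa using h8

end Splitting
section Stable

variable {R : Type*} [CommRing R] {ι κ τ : Type*} [Fintype ι] [Fintype κ] [Fintype τ]
  [DecidableEq ι] [DecidableEq κ] [DecidableEq τ]

/-- If `E` embeds `S` in `B` and the functionals `Eᵀ B` factor as `S ρ` with `ρ E = 1`, then `S` is
an orthogonal summand of `B`. -/
theorem cong_osum_of_retraction {B : Matrix κ κ R} (hB : B.IsSymm) {S : Matrix ι ι R}
    (E : Matrix κ ι R) (ρ : Matrix ι κ R) (W : Matrix κ τ R) (σ : Matrix τ κ R)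
    (hcard : Fintype.card κ = Fintype.card (ι ⊕ τ))
    (h1 : ρ * E = 1) (h2 : Eᵀ * B = S * ρ) (h3 : σ * W = 1) (h4 : ρ * W = 0) :
    Cong B (osum S (Wᵀ * B * W)) := by
  have hQP : fromRows ρ (σ - σ * E * ρ) * fromCols E W = 1 := by
    rw [fromRows_mul_fromCols, h1, h4, Matrix.sub_mul, Matrix.sub_mul, Matrix.mul_assoc _ ρ E, h1,
      Matrix.mul_assoc _ ρ W, h4, h3]
    simp
  refine ⟨fromCols E W, fromRows ρ (σ - σ * E * ρ), ?_, hQP, ?_⟩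
  · exact (mul_eq_one_comm_of_equiv (Fintype.equivOfCardEq hcard)).2 hQP
  · have h5 : Wᵀ * B * E = 0 := by
      have : (Eᵀ * B * W)ᵀ = Wᵀ * B * E := by
        simp [transpose_mul, hB.eq, Matrix.mul_assoc]
      rw [← this, h2, Matrix.mul_assoc, h4, Matrix.mul_zero, transpose_zero]
    rw [transpose_fromCols, fromRows_mul, fromRows_mul_fromCols, h2, Matrix.mul_assoc, h1,
      Matrix.mul_assoc, h4, h5]
    simp

theorem Cong.exists_det_eq [Nontrivial R] {A : Matrix ι ι R} {B : Matrix κ κ R} (h : Cong A B) :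
    ∃ u : Rˣ, B.det = u * A.det := by
  have hc := h.card_eq
  obtain ⟨P, Q, h1, h2, h3⟩ := h
  let e := Fintype.equivOfCardEq hc
  have hu : IsUnit (P.submatrix id e).det := by
    refine (Matrix.isUnit_iff_isUnit_det _).1 (IsUnit.of_mul_eq_one (Q.submatrix e id) ?_)
    rw [submatrix_mul_equiv, h1, submatrix_id_id]
  obtain ⟨u, hu⟩ := hu
  refine ⟨u * u, ?_⟩
  have : B.submatrix e e = (P.submatrix id e)ᵀ * A * P.submatrix id e := by
    rw [← h3]
    ext i j
    simp [Matrix.mul_apply]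
  rw [← det_submatrix_equiv_self e B, this, det_mul, det_mul, det_transpose, ← hu, Units.val_mul]
  ring

/-- The metabolic matrix with blocks `C`, `1`, `1`, `0`. -/
def metabolic (C : Matrix ι ι R) : Matrix (ι ⊕ ι) (ι ⊕ ι) R := fromBlocks C 1 1 0

theorem isUnit_det_metabolic (C : Matrix ι ι R) : IsUnit (metabolic C).det := by
  refine (Matrix.isUnit_iff_isUnit_det _).1 (IsUnit.of_mul_eq_one (fromBlocks 0 1 1 (-C)) ?_)
  simp [metabolic, fromBlocks_multiply]

omit [Fintype ι] in
theorem isSymm_metabolic {C : Matrix ι ι R} (hC : C.IsSymm) : (metabolic C).IsSymm := by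
  simp [metabolic, Matrix.IsSymm, fromBlocks_transpose, hC.eq]

theorem exists_cong_of_matrices {S : Matrix ι ι R} {T : Matrix κ κ R} (hS : S.IsSymm)
    (hT : T.IsSymm) {C : Matrix κ κ R} (hC : C.IsSymm) {H K : Matrix ι κ R} (h1 : H * T = S * K)
    (h2 : C * T + Hᵀ * K = 1) :
    ∃ V : Matrix (ι ⊕ κ) (ι ⊕ κ) R, V.IsSymm ∧ Cong (osum S (metabolic C)) (osum T V) := by
  have hB : (osum S (metabolic C)).IsSymm := by
    have := isSymm_metabolic hC
    rw [Matrix.IsSymm, fromBlocks_transpose, hS.eq, this.eq]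
    simp
  refine ⟨_, ?_, cong_osum_of_retraction hB (fromRows K (fromRows T 0))
    (fromCols Hᵀ (fromCols C 1)) (fromBlocks 1 0 (fromRows 0 (-Hᵀ)) (fromRows 1 (-C)))
    (fromBlocks 1 0 0 (fromCols 1 0)) ?_ ?_ ?_ ?_ ?_⟩
  · simp [Matrix.IsSymm, transpose_mul, hB.eq, Matrix.mul_assoc]
  · simp only [Fintype.card_sum]; ring
  · simp only [fromCols_mul_fromRows, Matrix.mul_zero, add_zero]
    rw [add_comm, h2]
  · have h1' : T * Hᵀ = Kᵀ * S := by
      rw [← hT.eq, ← transpose_mul, h1, transpose_mul, hS.eq]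
    rw [transpose_fromRows, transpose_fromRows, fromCols_mul_fromBlocks, metabolic,
      fromCols_mul_fromBlocks, mul_fromCols, mul_fromCols, h1', hT.eq]
    simp
  · rw [fromBlocks_multiply]
    simp [fromCols_mul_fromRows]
  · rw [fromCols_mul_fromBlocks]
    simp [fromCols_mul_fromRows]

end Stable
section Nonsingular

variable {ι κ : Type*} [Fintype ι] [Fintype κ] [DecidableEq ι] [DecidableEq κ]

theorem castQ_injective {ι κ : Type*} : Function.Injective (castQ : Matrix ι κ ℤ → Matrix ι κ ℚ) :=
  Matrix.map_injective Int.cast_injective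

theorem isUnit_det_castQ {A : Matrix ι ι ℤ} (hA : A.det ≠ 0) : IsUnit (castQ A).det := by
  have h : (castQ A).det = (A.det : ℚ) := by
    simpa [castQ] using (Int.cast_det (R := ℚ) A).symm
  rw [h, isUnit_iff_ne_zero]
  exact_mod_cast hA

omit [Fintype ι] in
theorem castQ_one : castQ (1 : Matrix ι ι ℤ) = 1 := by simp [castQ]

theorem castQ_add {ι κ : Type*} (A B : Matrix ι κ ℤ) : castQ (A + B) = castQ A + castQ B := by
  ext; simp [castQ]

/-- The class of an integral vector in the torsion group of a nonsingular matrix. -/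
noncomputable def torClass {A : Matrix ι ι ℤ} (hA : A.det ≠ 0) : (ι → ℤ) →ₗ[ℤ] Tor A :=
  (LinearMap.range A.mulVecLin).mkQ.codRestrict (Submodule.torsion ℤ (Coker A)) fun x =>
    Coker.mk_mem_torsion (u := (castQ A)⁻¹ *ᵥ vecRat x) (by
      rw [toRat_eq_castQ, mulVec_mulVec, mul_nonsing_inv _ (isUnit_det_castQ hA), one_mulVec])

theorem exists_matrices_of_linkEq {S : Matrix ι ι ℤ} (hS : S.IsSymm) {T : Matrix κ κ ℤ}
    (hT : T.IsSymm) (hS0 : S.det ≠ 0) (hT0 : T.det ≠ 0) (h : LinkEq S hS T hT) :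
    ∃ (C : Matrix κ κ ℤ) (H K : Matrix ι κ ℤ), C.IsSymm ∧ H * T = S * K ∧
      C * T + Hᵀ * K = 1 := by
  obtain ⟨ψ, hψ⟩ := h.symm
  have hHe : ∀ i : κ, ∃ x : ι → ℤ, torClass hS0 x = ψ (torClass hT0 (Pi.single i 1)) := by
    intro i
    obtain ⟨x, hx⟩ := Submodule.mkQ_surjective _
      ((ψ (torClass hT0 (Pi.single i 1)) : Tor S) : Coker S)
    exact ⟨x, Subtype.ext hx⟩
  choose h hh using hHe
  let H : Matrix ι κ ℤ := Matrix.of fun i j => h j i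
  have hH : ∀ x, torClass hS0 (H *ᵥ x) = ψ (torClass hT0 x) := by
    have : (torClass hS0) ∘ₗ H.mulVecLin = ψ.toIntLinearEquiv.toLinearMap ∘ₗ torClass hT0 := by
      refine LinearMap.pi_ext' fun i => LinearMap.ext_ring ?_
      simp only [LinearMap.comp_apply, LinearMap.single_apply, mulVecLin_apply]
      refine Eq.trans ?_ (hh i)
      congr 1
      ext j
      simp [H]
    exact fun x => LinearMap.congr_fun this x
  have hK : ∀ j : κ, ∃ z : ι → ℤ, S *ᵥ z = H *ᵥ (T *ᵥ Pi.single j 1) := by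
    intro j
    have h0 : torClass hT0 (T *ᵥ Pi.single j 1) = 0 := by
      refine Subtype.ext ?_
      exact (Submodule.Quotient.mk_eq_zero _).2 ⟨Pi.single j 1, rfl⟩
    have h1 : torClass hS0 (H *ᵥ (T *ᵥ Pi.single j 1)) = 0 := by rw [hH, h0, map_zero]
    obtain ⟨z, hz⟩ := (Submodule.Quotient.mk_eq_zero _).1 (congrArg Subtype.val h1)
    exact ⟨z, hz⟩
  choose k hk using hK
  let K : Matrix ι κ ℤ := Matrix.of fun i j => k j i
  have hHK : H * T = S * K := by
    ext i j
    have h1 := congrFun (hk j) i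
    rw [mulVec_mulVec] at h1
    have h2 : K *ᵥ Pi.single j 1 = k j := by ext; simp [K]
    rw [← h2, mulVec_mulVec] at h1
    simpa using h1.symm
  have hC : ∀ i j : κ, ∃ c : ℤ,
      (c : ℚ) = ((castQ T)⁻¹ - (castQ H)ᵀ * (castQ S)⁻¹ * castQ H) i j := by
    intro i j
    have h1 := hψ (torClass hT0 (Pi.single i 1)) (torClass hT0 (Pi.single j 1))
    rw [linkingPairing_eq_inv hT hT0 rfl rfl,
      linkingPairing_eq_inv hS hS0 (x := h i) (y := h j) (congrArg Subtype.val (hh i))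
        (congrArg Subtype.val (hh j)), eq_comm, ← sub_eq_zero, ← AddCircle.coe_sub,
      AddCircle.coe_eq_zero_iff] at h1
    obtain ⟨c, hc⟩ := h1
    refine ⟨c, ?_⟩
    rw [zsmul_one] at hc
    rw [hc, Matrix.sub_apply]
    congr 1
    · have : ∀ i : κ, vecRat (Pi.single i 1) = Pi.single i 1 := by
        intro i; ext i'; simp [vecRat, Pi.single_apply]
      rw [this, this, toRat_eq_castQ]
      simp
    · simp only [Matrix.mul_assoc, toRat_eq_castQ]
      rw [Matrix.mul_apply]
      simp only [dotProduct, mulVec, Matrix.mul_apply]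
      rfl
  choose C hC using hC
  have hCQ : castQ (Matrix.of C) = (castQ T)⁻¹ - (castQ H)ᵀ * (castQ S)⁻¹ * castQ H := by
    ext i j
    exact hC i j
  refine ⟨Matrix.of C, H, K, ?_, hHK, ?_⟩
  · apply castQ_injective
    rw [castQ_transpose, hCQ]
    simp only [transpose_sub, transpose_mul, transpose_nonsing_inv, ← castQ_transpose, hS.eq, hT.eq,
      transpose_transpose, Matrix.mul_assoc]
  · apply castQ_injective
    have h1 : (castQ S)⁻¹ * castQ H * castQ T = castQ K := by
      rw [Matrix.mul_assoc, ← castQ_mul, hHK, castQ_mul, ← Matrix.mul_assoc,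
        nonsing_inv_mul _ (isUnit_det_castQ hS0), Matrix.one_mul]
    rw [castQ_add, castQ_mul, castQ_mul, castQ_one, hCQ, Matrix.sub_mul,
      nonsing_inv_mul _ (isUnit_det_castQ hT0), ← h1, castQ_transpose]
    simp only [Matrix.mul_assoc]
    abel

theorem det_dvd_of_linkEq {S : Matrix ι ι ℤ} (hS : S.IsSymm) {T : Matrix κ κ ℤ}
    (hT : T.IsSymm) (hS0 : S.det ≠ 0) (hT0 : T.det ≠ 0) (h : LinkEq S hS T hT) :
    T.det ∣ S.det := by
  obtain ⟨C, H, K, hC, h1, h2⟩ := exists_matrices_of_linkEq hS hT hS0 hT0 h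
  obtain ⟨V, -, hV⟩ := exists_cong_of_matrices hS hT hC h1 h2
  obtain ⟨u, hu⟩ := hV.exists_det_eq
  rw [osum, osum, det_fromBlocks_zero₂₁, det_fromBlocks_zero₂₁] at hu
  obtain ⟨v, hv⟩ := isUnit_det_metabolic C
  rw [← hv] at hu
  have h3 : T.det ∣ (u * v : ℤˣ) * S.det := ⟨V.det, by rw [hu]; push_cast; ring⟩
  exact (Units.dvd_mul_left).1 h3

/-- Nonsingular matrices with isometric linking pairings become congruent after adding unimodular
matrices. -/
theorem exists_cong_of_linkEq {S : Matrix ι ι ℤ} (hS : S.IsSymm) {T : Matrix κ κ ℤ}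
    (hT : T.IsSymm) (hS0 : S.det ≠ 0) (hT0 : T.det ≠ 0) (h : LinkEq S hS T hT) :
    ∃ (U : Matrix (κ ⊕ κ) (κ ⊕ κ) ℤ) (V : Matrix (ι ⊕ κ) (ι ⊕ κ) ℤ), U.IsSymm ∧ V.IsSymm ∧
      IsUnit U.det ∧ IsUnit V.det ∧ Cong (osum S U) (osum T V) := by
  have hdvd := det_dvd_of_linkEq hT hS hT0 hS0 h.symm
  obtain ⟨C, H, K, hC, h1, h2⟩ := exists_matrices_of_linkEq hS hT hS0 hT0 h
  obtain ⟨V, hVs, hV⟩ := exists_cong_of_matrices hS hT hC h1 h2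
  refine ⟨metabolic C, V, isSymm_metabolic hC, hVs, isUnit_det_metabolic C, ?_, hV⟩
  obtain ⟨u, hu⟩ := hV.exists_det_eq
  rw [osum, osum, det_fromBlocks_zero₂₁, det_fromBlocks_zero₂₁] at hu
  obtain ⟨v, hv⟩ := isUnit_det_metabolic C
  obtain ⟨x, hx⟩ := hdvd
  rw [← hv, hx] at hu
  have h3 : x * V.det = (u * v : ℤˣ) := by
    refine mul_left_cancel₀ hS0 ?_
    rw [← mul_assoc, hu]; push_cast; ring
  exact isUnit_of_mul_isUnit_right (h3 ▸ Units.isUnit _)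

end Nonsingular
section VecRat

variable {τ : Type*}

theorem vecRat_add (x y : τ → ℤ) : vecRat (x + y) = vecRat x + vecRat y := by
  ext; simp [vecRat]

theorem vecRat_zero : vecRat (0 : τ → ℤ) = 0 := by
  ext; simp [vecRat]

theorem vecRat_smul (c : ℤ) (x : τ → ℤ) : vecRat (c • x) = (c : ℚ) • vecRat x := by
  ext; simp [vecRat]

end VecRat

section Blocks

variable {R ι κ τ : Type*} [AddCommMonoid R]

theorem fromRows_add_fromRows (A A' : Matrix ι τ R) (B B' : Matrix κ τ R) :
    fromRows A B + fromRows A' B' = fromRows (A + A') (B + B') := by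
  ext (i | i) j <;> simp

theorem fromCols_add_fromCols (A A' : Matrix τ ι R) (B B' : Matrix τ κ R) :
    fromCols A B + fromCols A' B' = fromCols (A + A') (B + B') := by
  ext i (j | j) <;> simp

theorem fromCols_fromRows_zero {υ : Type*} (A : Matrix ι τ R) (B : Matrix κ τ R) :
    fromCols (fromRows A B) (0 : Matrix (ι ⊕ κ) υ R) = fromBlocks A 0 B 0 := by
  ext (i | i) (j | j) <;> simp

end Blocks

section Metabolic

variable {R : Type*} [CommRing R] {ι κ : Type*} [Fintype ι] [Fintype κ]
  [DecidableEq ι] [DecidableEq κ]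

/-- Stable triviality: `A ⊕ I_r ⊕ (-I_s)` is congruent to some `I_r' ⊕ (-I_s')`. -/
def StabTriv (A : Matrix ι ι R) : Prop := Stab A (0 : Matrix (Fin 0) (Fin 0) R)

theorem StabTriv.osum_left {U : Matrix κ κ R} (hU : StabTriv U) (A : Matrix ι ι R) :
    Stab (osum A U) A :=
  ((Stab.refl A).osum hU).trans (osum_empty _ _).stab

theorem stabTriv_sgn (r s : ℕ) : StabTriv (sgn R r s) :=
  ((osum_comm _ _).trans (osum_empty _ _)).symm.stab.trans (stab_sgn _ r s)

theorem cong_neg_sgn (r s : ℕ) : Cong (-sgn R r s) (sgn R s r) := by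
  have : -sgn R r s = osum (-1) 1 := by simp [sgn, fromBlocks_neg]
  rw [this]
  exact osum_comm _ _

theorem metabolic_osum_one (C X Y : Matrix ι ι R) :
    Cong (osum (metabolic C) (1 : Matrix ι ι R)) (osum (metabolic (C + Y + Yᵀ + Xᵀ * X)) (1 : Matrix ι ι R)) := by
  refine ⟨fromBlocks (fromBlocks 1 0 Y 1) (fromRows 0 (-Xᵀ)) (fromCols X 0) 1,
    fromBlocks (fromBlocks 1 0 (-Y - Xᵀ * X) 1) (fromRows 0 Xᵀ) (fromCols (-X) 0) 1, ?_, ?_, ?_⟩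
  · have e : Y + (-Y - Xᵀ * X) + Xᵀ * X = 0 := by abel
    simp [e, fromBlocks_multiply, fromCols_fromRows_zero, fromBlocks_mul_fromRows,
      fromCols_mul_fromBlocks, fromCols_mul_fromRows, fromBlocks_add, fromRows_add_fromRows,
      fromCols_add_fromCols]
  · have e : -Y - Xᵀ * X + Y + Xᵀ * X = 0 := by abel
    simp [e, fromBlocks_multiply, fromCols_fromRows_zero, fromBlocks_mul_fromRows,
      fromCols_mul_fromBlocks, fromCols_mul_fromRows, fromBlocks_add, fromRows_add_fromRows,
      fromCols_add_fromCols]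
  · simp only [osum, metabolic, fromBlocks_transpose, fromBlocks_multiply,
      transpose_fromRows, transpose_fromCols, Matrix.mul_one, Matrix.mul_zero, fromBlocks_inj]
    simp [fromBlocks_multiply, fromCols_fromRows_zero, fromBlocks_mul_fromRows,
      fromCols_mul_fromBlocks, fromCols_mul_fromRows, fromBlocks_add, fromRows_add_fromRows,
      fromCols_add_fromCols, fromRows_mul]
    abel

theorem metabolic_one_cong (k : ℕ) : Cong (metabolic (1 : Matrix (Fin k) (Fin k) R)) (sgn R k k) := by
  refine ⟨fromBlocks 1 (-1) 0 1, fromBlocks 1 1 0 1, ?_, ?_, ?_⟩ <;>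
    simp [fromBlocks_multiply, metabolic, sgn, fromBlocks_transpose]

theorem cong_one_sgn (k : ℕ) : Cong (1 : Matrix (Fin k) (Fin k) R) (sgn R k 0) :=
  (osum_empty _ _).symm

theorem stabTriv_metabolic {k : ℕ} {C : Matrix (Fin k) (Fin k) ℤ} (hC : C.IsSymm) :
    StabTriv (metabolic C) := by
  let X : Matrix (Fin k) (Fin k) ℤ := diagonal fun i => 1 + C i i
  let Y : Matrix (Fin k) (Fin k) ℤ := of fun i j =>
    if i < j then -C i j else if i = j then -((C i i * (C i i + 3)) / 2) else 0
  have h1 : C + Y + Yᵀ + Xᵀ * X = 1 := by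
    ext i j
    rcases lt_trichotomy i j with h | rfl | h
    · simp [X, Y, h, h.ne, h.ne', h.not_gt]
    · have h2 : C i i * (C i i + 3) / 2 * 2 = C i i * (C i i + 3) := by
        refine Int.ediv_mul_cancel (even_iff_two_dvd.1 ?_)
        rw [Int.even_mul, Int.even_add]
        by_cases h : Even (C i i) <;> simp [h]; decide
      simp [X, Y]
      linarith
    · simp [X, Y, h, h.ne', h.not_gt, hC.apply i j]
  have h3 := metabolic_osum_one C X Y
  rw [h1] at h3
  have h4 : Stab (osum (metabolic C) (sgn ℤ k 0)) (osum (sgn ℤ k k) (sgn ℤ k 0)) :=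
    (((Cong.refl _).osum (cong_one_sgn k).symm).trans
      (h3.trans ((metabolic_one_cong k).osum (cong_one_sgn k)))).stab
  exact (stab_sgn _ k 0).symm.trans (h4.trans ((stab_sgn _ k 0).trans (stabTriv_sgn k k)))

/-- A unimodular form vanishing on a half of a basis is metabolic. -/
theorem exists_cong_metabolic {k : ℕ} {B C : Matrix (Fin k) (Fin k) ℤ}
    (hdet : IsUnit (fromBlocks 0 B Bᵀ C).det) :
    Cong (fromBlocks 0 B Bᵀ C) (metabolic C) := by
  have hB : ∃ Z, B * Z = 1 := by
    have h := mul_nonsing_inv _ hdet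
    rw [← fromBlocks_toBlocks (fromBlocks 0 B Bᵀ C)⁻¹, fromBlocks_multiply, ← fromBlocks_one,
      fromBlocks_inj] at h
    exact ⟨_, by simpa using h.1⟩
  obtain ⟨Z, hZ⟩ := hB
  have hZ' := mul_eq_one_comm.1 hZ
  have hZt : Bᵀ * Zᵀ = 1 := by rw [← transpose_mul, hZ', transpose_one]
  have hZt' : Zᵀ * Bᵀ = 1 := by rw [← transpose_mul, hZ, transpose_one]
  refine ⟨fromBlocks 0 Zᵀ 1 0, fromBlocks 0 1 Bᵀ 0, ?_, ?_, ?_⟩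
  · simp [fromBlocks_multiply, hZt']
  · simp [fromBlocks_multiply, hZt]
  · simp [fromBlocks_multiply, metabolic, fromBlocks_transpose, hZ', hZt]

theorem exists_castQ_eq_smul {ι κ : Type*} [Finite ι] [Finite κ] (P : Matrix ι κ ℚ) :
    ∃ (d : ℤ) (M : Matrix ι κ ℤ), d ≠ 0 ∧ castQ M = (d : ℚ) • P := by
  obtain ⟨d, hd⟩ := IsLocalization.exist_integer_multiples_of_finite (nonZeroDivisors ℤ)
    (fun p : ι × κ => P p.1 p.2)
  choose M hM using hd
  refine ⟨d, of fun i j => M (i, j), nonZeroDivisors.coe_ne_zero d, ?_⟩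
  ext i j
  simpa [castQ] using hM (i, j)

theorem stabTriv_of_castQ_cong {X : Matrix ι ι ℤ} (hX : X.IsSymm) (hXu : IsUnit X.det)
    {D : Matrix κ κ ℤ} (hD : D.IsSymm) (hDu : IsUnit D.det) (h : Cong (castQ X) (castQ D)) :
    StabTriv (osum X (-D)) := by
  have hcard := h.card_eq
  obtain ⟨P, Q, h1, h2, h3⟩ := h
  let S : Submodule ℤ (ι ⊕ κ → ℤ) :=
    { carrier := {y | vecRat (y ∘ Sum.inl) = P *ᵥ vecRat (y ∘ Sum.inr)}
      add_mem' := by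
        intro a b ha hb
        change vecRat _ = _ at ha hb
        change vecRat (a ∘ Sum.inl + b ∘ Sum.inl) = P *ᵥ vecRat (a ∘ Sum.inr + b ∘ Sum.inr)
        rw [vecRat_add, vecRat_add, mulVec_add, ha, hb]
      zero_mem' := by
        change vecRat 0 = P *ᵥ vecRat 0
        rw [vecRat_zero, vecRat_zero, mulVec_zero]
      smul_mem' := by
        intro c a ha
        change vecRat _ = _ at ha
        change vecRat (c • (a ∘ Sum.inl)) = P *ᵥ vecRat (c • (a ∘ Sum.inr))
        rw [vecRat_smul, vecRat_smul, mulVec_smul, ha] }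
  have hmem : ∀ y, y ∈ S ↔ vecRat (y ∘ Sum.inl) = P *ᵥ vecRat (y ∘ Sum.inr) := fun _ => Iff.rfl
  have hsat : ∀ (n : ℤ) (y : ι ⊕ κ → ℤ), n ≠ 0 → n • y ∈ S → y ∈ S := by
    intro n y hn hy
    rw [hmem] at hy ⊢
    change vecRat (n • (y ∘ Sum.inl)) = P *ᵥ vecRat (n • (y ∘ Sum.inr)) at hy
    rw [vecRat_smul, vecRat_smul, mulVec_smul] at hy
    exact smul_right_injective _ (by exact_mod_cast hn : (n : ℚ) ≠ 0) hy
  have hrank : Module.finrank ℤ S = Fintype.card κ := by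
    apply le_antisymm
    · rw [← Module.finrank_fintype_fun_eq_card ℤ]
      refine LinearMap.finrank_le_finrank_of_injective
        (f := (LinearMap.funLeft ℤ ℤ Sum.inr) ∘ₗ S.subtype) ?_
      rw [injective_iff_map_eq_zero]
      intro y hy
      have hr : (y : ι ⊕ κ → ℤ) ∘ Sum.inr = 0 := hy
      have hl := (hmem y).1 y.2
      rw [hr] at hl
      apply Subtype.ext
      ext (i | i)
      · have := congrFun hl i
        rw [vecRat_zero, mulVec_zero] at this
        simpa [vecRat] using this
      · exact congrFun hr i
    · obtain ⟨d, M, hd, hM⟩ := exists_castQ_eq_smul P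
      rw [← Module.finrank_fintype_fun_eq_card ℤ]
      refine LinearMap.finrank_le_finrank_of_injective
        (f := LinearMap.codRestrict S (fromRows M (d • (1 : Matrix κ κ ℤ))).mulVecLin ?_) ?_
      · intro x
        rw [hmem]
        have e1 : ((fromRows M (d • (1 : Matrix κ κ ℤ))).mulVecLin x) ∘ Sum.inl = M *ᵥ x := by
          ext; simp [fromRows_mulVec]
        have e2 : ((fromRows M (d • (1 : Matrix κ κ ℤ))).mulVecLin x) ∘ Sum.inr = d • x := by
          ext; simp [fromRows_mulVec]
        rw [e1, e2, ← castQ_mulVec_vecRat, hM, vecRat_smul, mulVec_smul, smul_mulVec]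
      · rw [injective_iff_map_eq_zero]
        intro x hx
        have := congrArg (fun z : S => (z : ι ⊕ κ → ℤ) ∘ Sum.inr) hx
        have e2 : ((fromRows M (d • (1 : Matrix κ κ ℤ))).mulVecLin x) ∘ Sum.inr = d • x := by
          ext; simp [fromRows_mulVec]
        have e4 : d • x = 0 := e2.symm.trans this
        exact (smul_eq_zero.1 e4).resolve_left hd
  have hiso : ∀ y ∈ S, ∀ z ∈ S, y ⬝ᵥ (osum X (-D) *ᵥ z) = 0 := by
    intro y hy z hz
    rw [hmem] at hy hz
    have e : ((y ⬝ᵥ (osum X (-D) *ᵥ z) : ℤ) : ℚ) =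
        vecRat (y ∘ Sum.inl) ⬝ᵥ (castQ X *ᵥ vecRat (z ∘ Sum.inl)) -
        vecRat (y ∘ Sum.inr) ⬝ᵥ (castQ D *ᵥ vecRat (z ∘ Sum.inr)) := by
      rw [castQ_mulVec_vecRat, castQ_mulVec_vecRat, osum, fromBlocks_mulVec]
      simp [dotProduct, vecRat, neg_mulVec, sub_eq_add_neg]
    rw [hy, hz, ← h3, ← mulVec_mulVec, ← mulVec_mulVec, dotProduct_mulVec _ Pᵀ, vecMul_transpose,
      sub_self] at e
    exact_mod_cast e
  obtain ⟨l, P', Q', h1', h2', h3'⟩ := exists_matrix_of_saturated S hsat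
  have hW : Cong (osum X (-D)) (P'ᵀ * osum X (-D) * P') := ⟨P', Q', h1', h2', rfl⟩
  have hWs : (osum X (-D)).IsSymm := isSymm_osum hX (by simp [Matrix.IsSymm, hD.eq])
  have hWu : IsUnit (osum X (-D)).det := by
    rw [osum, det_fromBlocks_zero₂₁, det_neg]
    exact hXu.mul ((isUnit_one.neg.pow _).mul hDu)
  have hc := hW.card_eq
  have hl : l = Module.finrank ℤ S := by
    rw [hrank]
    simp only [Fintype.card_sum, Fintype.card_fin, hrank] at hc
    omega
  generalize Module.finrank ℤ S = k at *
  subst hl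
  have hzero : (P'ᵀ * osum X (-D) * P').toBlocks₁₁ = 0 := by
    have hin : ∀ i, P' *ᵥ Pi.single (Sum.inl i) 1 ∈ S := by
      intro i
      rw [h3']
      intro j
      rw [mulVec_mulVec, h2']
      simp
    ext i j
    have := hiso _ (hin i) _ (hin j)
    rw [← vecMul_transpose, ← dotProduct_mulVec, mulVec_mulVec, mulVec_mulVec] at this
    simpa [toBlocks₁₁, Matrix.mul_assoc] using this
  have hs := hW.isSymm hWs
  have h21 : (P'ᵀ * osum X (-D) * P').toBlocks₂₁ = (P'ᵀ * osum X (-D) * P').toBlocks₁₂ᵀ := by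
    ext i j
    exact hs.apply _ _
  have hblocks := fromBlocks_toBlocks (P'ᵀ * osum X (-D) * P')
  rw [hzero, h21] at hblocks
  have hC : (P'ᵀ * osum X (-D) * P').toBlocks₂₂.IsSymm := by
    ext i j
    exact hs.apply _ _
  have hu : IsUnit (P'ᵀ * osum X (-D) * P').det := by
    obtain ⟨u, hu⟩ := hW.exists_det_eq
    rw [hu]
    exact (Units.isUnit u).mul hWu
  rw [← hblocks] at hu
  have hfin := hW.trans ((Cong.of_eq hblocks.symm).trans (exists_cong_metabolic hu))
  exact hfin.stab.trans (stabTriv_metabolic hC)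

theorem castQ_sgn (r s : ℕ) : castQ (sgn ℤ r s) = sgn ℚ r s := by
  ext (i | i) (j | j) <;> simp [castQ, sgn, Matrix.one_apply, apply_ite]

theorem castQ_osum {ι κ : Type*} (A : Matrix ι ι ℤ) (B : Matrix κ κ ℤ) :
    castQ (osum A B) = osum (castQ A) (castQ B) := by
  ext (i | i) (j | j) <;> simp [castQ]

theorem isUnit_det_osum {A : Matrix ι ι R} {B : Matrix κ κ R} (hA : IsUnit A.det)
    (hB : IsUnit B.det) : IsUnit (osum A B).det := by
  rw [osum, det_fromBlocks_zero₂₁]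
  exact hA.mul hB

/-- A unimodular form which is stably trivial over `ℚ` is stably trivial over `ℤ`. -/
theorem stabTriv_of_castQ {U : Matrix ι ι ℤ} (hU : U.IsSymm) (hUu : IsUnit U.det)
    (h : StabTriv (castQ U)) : StabTriv U := by
  obtain ⟨r, s, r', s', h⟩ := h
  have h1 : Cong (castQ (osum U (sgn ℤ r s))) (castQ (sgn ℤ r' s')) := by
    rw [castQ_osum, castQ_sgn, castQ_sgn]
    exact h.trans ((osum_comm _ _).trans (osum_empty _ _))
  have h2 := stabTriv_of_castQ_cong (isSymm_osum hU (isSymm_sgn r s))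
    (isUnit_det_osum hUu (isUnit_det_sgn r s)) (isSymm_sgn r' s') (isUnit_det_sgn r' s') h1
  have h3 : Stab (osum (osum U (sgn ℤ r s)) (-sgn ℤ r' s')) U :=
    ((stab_sgn U r s).osum (cong_neg_sgn r' s').stab).trans (stab_sgn U s' r')
  exact h3.symm.trans h2

end Metabolic
section Smooth

/-- `a ≠ 0` and all prime divisors of `a` are less than `p`. -/
def Smooth (p : ℕ) (a : ℤ) : Prop := a ≠ 0 ∧ ∀ q : ℕ, q.Prime → (q : ℤ) ∣ a → q < p

variable {p : ℕ} {a b : ℤ}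

theorem Smooth.mul (ha : Smooth p a) (hb : Smooth p b) : Smooth p (a * b) := by
  refine ⟨mul_ne_zero ha.1 hb.1, fun q hq h => ?_⟩
  rcases (Nat.prime_iff_prime_int.1 hq).dvd_or_dvd h with h | h
  · exact ha.2 q hq h
  · exact hb.2 q hq h

theorem Smooth.neg (ha : Smooth p a) : Smooth p (-a) :=
  ⟨neg_ne_zero.2 ha.1, fun q hq h => ha.2 q hq ((dvd_neg).1 h)⟩

theorem Smooth.of_mul_right (h : Smooth p (a * b)) : Smooth p b :=
  ⟨right_ne_zero_of_mul h.1, fun q hq hd => h.2 q hq (hd.mul_left a)⟩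

theorem smooth_of_abs_lt (ha : a ≠ 0) (h : |a| < p) : Smooth p a := by
  refine ⟨ha, fun q _ hd => ?_⟩
  have := Int.le_of_dvd (abs_pos.2 ha) ((dvd_abs _ _).2 hd)
  exact_mod_cast this.trans_lt h

theorem smooth_one (hp : p.Prime) : Smooth p 1 :=
  smooth_of_abs_lt one_ne_zero (by simpa using hp.one_lt)

theorem Smooth.not_dvd (hp : p.Prime) (ha : Smooth p a) : ¬ (p : ℤ) ∣ a :=
  fun h => lt_irrefl _ (ha.2 p hp h)

theorem Smooth.of_succ (hp : ¬ p.Prime) (ha : Smooth (p + 1) a) : Smooth p a := by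
  refine ⟨ha.1, fun q hq h => lt_of_le_of_ne (Nat.lt_succ_iff.1 (ha.2 q hq h)) ?_⟩
  rintro rfl
  exact hp hq

theorem Smooth.eq_one_or (ha : Smooth 2 a) : a = 1 ∨ a = -1 := by
  have h : a.natAbs = 1 := by
    by_contra h
    obtain ⟨q, hq, hd⟩ := Nat.exists_prime_and_dvd h
    exact absurd (ha.2 q hq (Int.natCast_dvd.2 hd)) (not_lt.2 hq.two_le)
  exact Int.natAbs_eq_iff.1 h

theorem emod_pos_of_not_dvd (hp : 0 < p) (h : ¬ (p : ℤ) ∣ a) : 0 < a % p :=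
  lt_of_le_of_ne (Int.emod_nonneg _ (by exact_mod_cast hp.ne'))
    fun h0 => h (Int.dvd_of_emod_eq_zero h0.symm)

theorem smooth_emod (hp : p.Prime) (h : ¬ (p : ℤ) ∣ a) : Smooth p (a % p) := by
  have h1 := emod_pos_of_not_dvd hp.pos h
  refine smooth_of_abs_lt h1.ne' ?_
  rw [abs_of_pos h1]
  exact Int.emod_lt_of_pos _ (by exact_mod_cast hp.pos)

end Smooth

section Residue

variable {G : Type*} [AddCommGroup G]

/-- The relations between the classes `g a = ⟨a⟩` of rank one forms in the rational Witt group
modulo `⟨1⟩`. -/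
structure WittRelations (g : ℤ → G) : Prop where
  sq : ∀ a b, a ≠ 0 → b ≠ 0 → g (a * b ^ 2) = g a
  neg : ∀ a, a ≠ 0 → g (-a) = -g a
  one : g 1 = 0
  add : ∀ a b, a ≠ 0 → b ≠ 0 → a + b ≠ 0 → g a + g b = g (a + b) + g (a * b * (a + b))

/-- The subgroup generated by the classes of integers with prime divisors less than `p`. -/
def smoothSubgroup (g : ℤ → G) (p : ℕ) : AddSubgroup G :=
  AddSubgroup.closure {x | ∃ a, Smooth p a ∧ g a = x}

theorem mem_smoothSubgroup {g : ℤ → G} {p : ℕ} {a : ℤ} (ha : Smooth p a) :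
    g a ∈ smoothSubgroup g p :=
  AddSubgroup.subset_closure ⟨a, ha, rfl⟩

variable {g : ℤ → G} (hg : WittRelations g) {p : ℕ} (hp : p.Prime)

include hg hp

theorem WittRelations.sub_mem_of_eq_add {x n m d : ℤ} (hx : Smooth p x) (hn : Smooth p n)
    (hm : Smooth p m) (hd : Smooth p d) (h : x = n + p * m) :
    g (p * (d * x)) - g (p * (d * n)) ∈ smoothSubgroup g p := by
  have hp0 : (p : ℤ) ≠ 0 := by exact_mod_cast hp.ne_zero
  have hd' := (hd.mul hm).mul hn
  have hsum : d * m * n * n + d * m * n * (p * m) = d * m * n * x := by rw [h]; ring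
  have h1 := hg.add (d * m * n * n) (d * m * n * (p * m)) (hd'.mul hn).1
    (mul_ne_zero hd'.1 (mul_ne_zero hp0 hm.1)) (by rw [hsum]; exact (hd'.mul hx).1)
  rw [hsum] at h1
  have h2 : g (d * m * n * (p * m)) = g (p * (d * n)) := by
    rw [← hg.sq (p * (d * n)) m (mul_ne_zero hp0 (hd.mul hn).1) hm.1]
    congr 1; ring
  have h3 : g (d * m * n * n * (d * m * n * (p * m)) * (d * m * n * x)) = g (p * (d * x)) := by
    rw [← hg.sq (p * (d * x)) (d * m ^ 2 * n ^ 2) (mul_ne_zero hp0 (hd.mul hx).1)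
      (mul_ne_zero (mul_ne_zero hd.1 (pow_ne_zero _ hm.1)) (pow_ne_zero _ hn.1))]
    congr 1; ring
  rw [h2, h3] at h1
  have h4 : g (p * (d * x)) - g (p * (d * n)) = g (d * m * n * n) - g (d * m * n * x) := by
    rw [sub_eq_sub_iff_add_eq_add, add_comm, ← h1, add_comm]
  rw [h4]
  exact sub_mem (mem_smoothSubgroup (hd'.mul hn)) (mem_smoothSubgroup (hd'.mul hx))

theorem WittRelations.sub_emod_mem {c d : ℤ} (hc : Smooth p c) (hd : Smooth p d) :
    g (p * (d * c)) - g (p * (d * (c % p))) ∈ smoothSubgroup g p := by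
  have hp0 : (0 : ℤ) < p := by exact_mod_cast hp.pos
  induction h : c.natAbs using Nat.strong_induction_on generalizing c d with
  | _ N ih =>
    by_cases hlt : |c| < p
    · rcases le_or_gt 0 c with h0 | h0
      · rw [Int.emod_eq_of_lt h0 (by rwa [abs_of_nonneg h0] at hlt), sub_self]
        exact zero_mem _
      · have h1 : c % p = c + p := by
          rw [abs_of_neg h0] at hlt
          rw [← Int.add_emod_right, Int.emod_eq_of_lt (by linarith) (by linarith)]
        refine hg.sub_mem_of_eq_add hp (m := -1) hc (smooth_emod hp (hc.not_dvd hp))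
          (smooth_one hp).neg hd ?_
        rw [h1]; ring
    · have hN : c.natAbs ≠ 1 := by
        have := hp.two_le
        rw [Int.abs_eq_natAbs] at hlt
        omega
      obtain ⟨q, hq, c', hc'⟩ := Nat.exists_prime_and_dvd hN
      obtain ⟨c'', rfl⟩ : ∃ c'', c = q * c'' := by
        obtain ⟨t, ht⟩ := Int.natCast_dvd.2 (Dvd.intro _ hc'.symm)
        exact ⟨t, ht⟩
      have hqp : q < p := hc.2 q hq (Dvd.intro _ rfl)
      have hqs : Smooth p q := smooth_of_abs_lt (by exact_mod_cast hq.ne_zero) (by simpa using hqp)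
      have hs := hc.of_mul_right
      have hr := smooth_emod hp (hs.not_dvd hp)
      have h1 := ih c''.natAbs (by
        rw [← h, Int.natAbs_mul, Int.natAbs_natCast]
        have := Int.natAbs_pos.2 hs.1
        nlinarith [hq.two_le]) hs (hd.mul hqs) rfl
      have h2 : g (p * (d * (q * (c'' % p)))) - g (p * (d * ((q * c'') % p))) ∈
          smoothSubgroup g p := by
        have h3 : (q * c'') % p = (q * (c'' % p)) % (p : ℤ) := by
          rw [Int.mul_emod, Int.mul_emod (q : ℤ) (c'' % p), Int.emod_emod_of_dvd _ dvd_rfl]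
        rw [h3]
        have h4 := Int.emod_add_mul_ediv (q * (c'' % p)) p
        have h5 := emod_pos_of_not_dvd hp.pos (hs.not_dvd hp)
        have h6 := Int.emod_lt_of_pos c'' hp0
        by_cases hm : (q * (c'' % p)) / (p : ℤ) = 0
        · rw [hm, mul_zero, add_zero] at h4
          rw [h4, sub_self]
          exact zero_mem _
        · refine hg.sub_mem_of_eq_add hp (hqs.mul hr)
            (smooth_emod hp ((hqs.mul hr).not_dvd hp)) (smooth_of_abs_lt hm ?_) hd h4.symm
          have h7 : 0 ≤ (q * (c'' % p)) / (p : ℤ) :=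
            Int.ediv_nonneg (mul_nonneg (Int.natCast_nonneg _) h5.le) hp0.le
          rw [abs_of_nonneg h7]
          apply Int.ediv_lt_of_lt_mul hp0
          have : (q : ℤ) < p := by exact_mod_cast hqp
          nlinarith
      have h8 := add_mem h1 h2
      rw [show d * q * c'' = d * (q * c'') by ring,
        show d * q * (c'' % p) = d * (q * (c'' % p)) by ring, sub_add_sub_cancel] at h8
      exact h8

theorem WittRelations.sub_mem_of_modEq {c c' : ℤ} (hc : Smooth p c) (hc' : Smooth p c')
    (h : c ≡ c' [ZMOD p]) : g (p * c) - g (p * c') ∈ smoothSubgroup g p := by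
  have h1 := hg.sub_emod_mem hp hc (smooth_one hp)
  have h2 := hg.sub_emod_mem hp hc' (smooth_one hp)
  rw [show c % p = c' % p from h] at h1
  have h3 := sub_mem h1 h2
  simpa using h3

theorem WittRelations.sub_mem_of_modEq_mul_sq {c r α : ℤ} (hc : Smooth p c) (hr : Smooth p r)
    (hα : ¬ (p : ℤ) ∣ α) (h : c * α ^ 2 ≡ r [ZMOD p]) :
    g (p * c) - g (p * r) ∈ smoothSubgroup g p := by
  have hp0 : (p : ℤ) ≠ 0 := by exact_mod_cast hp.ne_zero
  have ha := smooth_emod hp hα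
  have hca : Smooth p (c * (α % p) ^ 2) := hc.mul (pow_two (α % p) ▸ ha.mul ha)
  have h1 : c * (α % p) ^ 2 ≡ r [ZMOD p] := (((Int.mod_modEq α p).pow 2).mul_left c).trans h
  have h2 := hg.sub_mem_of_modEq hp hca hr h1
  rwa [← mul_assoc, hg.sq _ _ (mul_ne_zero hp0 hc.1) ha.1] at h2

theorem WittRelations.add_mem_of_isotropic {c c' α β : ℤ} (hc : Smooth p c) (hc' : Smooth p c')
    (hα : ¬ (p : ℤ) ∣ α) (hβ : ¬ (p : ℤ) ∣ β) (h : (p : ℤ) ∣ c * α ^ 2 + c' * β ^ 2) :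
    g (p * c) + g (p * c') ∈ smoothSubgroup g p := by
  have hp0 : (p : ℤ) ≠ 0 := by exact_mod_cast hp.ne_zero
  have hn : ¬ (p : ℤ) ∣ c * α ^ 2 := fun hd =>
    ((Nat.prime_iff_prime_int.1 hp).dvd_or_dvd hd).elim (hc.not_dvd hp)
      fun hd => hα ((Nat.prime_iff_prime_int.1 hp).dvd_of_dvd_pow hd)
  have hr := smooth_emod hp hn
  have h1 := hg.sub_mem_of_modEq_mul_sq hp hc hr hα (Int.mod_modEq _ _).symm
  have h2 := hg.sub_mem_of_modEq_mul_sq hp hc' hr.neg hβ (by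
    refine Int.ModEq.trans ?_ (Int.mod_modEq _ _).neg.symm
    refine (Int.modEq_iff_dvd.2 ?_).symm
    rwa [sub_neg_eq_add, add_comm])
  rw [mul_neg, hg.neg _ (mul_ne_zero hp0 hr.1)] at h2
  have h3 := add_mem h1 h2
  simpa using h3

theorem WittRelations.exists_triple {a b c : ℤ} (ha : Smooth p a) (hb : Smooth p b)
    (hc : Smooth p c) :
    ∃ l : List ℤ, l.length ≤ 1 ∧ (∀ e ∈ l, Smooth p e) ∧
      g (p * a) + g (p * b) + g (p * c) - (l.map fun e => g (p * e)).sum ∈ smoothSubgroup g p := by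
  have hp0 : (p : ℤ) ≠ 0 := by exact_mod_cast hp.ne_zero
  have hpp : ¬ (p : ℤ) ∣ 1 := (smooth_one hp).not_dvd hp
  have : Fact p.Prime := ⟨hp⟩
  rcases hp.eq_two_or_odd with h2 | hodd
  · refine ⟨[c], by simp, by simpa using hc, ?_⟩
    have := hg.add_mem_of_isotropic hp ha hb hpp hpp (by
      have h3 := ha.not_dvd hp
      have h4 := hb.not_dvd hp
      subst h2
      push_cast at *
      omega)
    simpa using this
  · obtain ⟨α, β, hαβ⟩ : ∃ α β : ℤ, a * α ^ 2 + b * β ^ 2 ≡ -c [ZMOD p] := by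
      have hne : ∀ {x : ℤ}, Smooth p x → (x : ZMod p) ≠ 0 := fun hx h0 =>
        hx.not_dvd hp ((ZMod.intCast_zmod_eq_zero_iff_dvd _ _).1 h0)
      obtain ⟨x, y, hxy⟩ := FiniteField.exists_root_sum_quadratic
        (f := Polynomial.C (a : ZMod p) * Polynomial.X ^ 2)
        (g := Polynomial.C (b : ZMod p) * Polynomial.X ^ 2 + Polynomial.C 0 * Polynomial.X +
          Polynomial.C (c : ZMod p))
        (Polynomial.degree_C_mul_X_pow 2 (hne ha)) (Polynomial.degree_quadratic (hne hb))
        (by rwa [ZMod.card])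
      obtain ⟨α, rfl⟩ := ZMod.intCast_surjective x
      obtain ⟨β, rfl⟩ := ZMod.intCast_surjective y
      refine ⟨α, β, (ZMod.intCast_eq_intCast_iff _ _ _).1 ?_⟩
      simp at hxy
      push_cast
      linear_combination hxy
    have hdvd : (p : ℤ) ∣ a * α ^ 2 + b * β ^ 2 + c := by
      have := (Int.modEq_iff_dvd.1 hαβ.symm)
      simpa using this
    have hc0 := hc.not_dvd hp
    by_cases hα : (p : ℤ) ∣ α
    · have hd1 : (p : ℤ) ∣ b * β ^ 2 + c * 1 ^ 2 := by
        have h3 := dvd_sub hdvd ((hα.pow two_ne_zero).mul_left a)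
        rwa [show a * α ^ 2 + b * β ^ 2 + c - a * α ^ 2 = b * β ^ 2 + c * 1 ^ 2 by ring] at h3
      have hβ : ¬ (p : ℤ) ∣ β := fun h => hc0 (by
        have := dvd_sub hd1 ((h.pow two_ne_zero).mul_left b)
        simpa using this)
      have := hg.add_mem_of_isotropic hp hb hc hβ hpp hd1
      refine ⟨[a], by simp, by simpa using ha, ?_⟩
      convert this using 1
      simp; abel
    by_cases hβ : (p : ℤ) ∣ β
    · have hd1 : (p : ℤ) ∣ a * α ^ 2 + c * 1 ^ 2 := by
        have h3 := dvd_sub hdvd ((hβ.pow two_ne_zero).mul_left b)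
        rwa [show a * α ^ 2 + b * β ^ 2 + c - b * β ^ 2 = a * α ^ 2 + c * 1 ^ 2 by ring] at h3
      have := hg.add_mem_of_isotropic hp ha hc hα hpp hd1
      refine ⟨[b], by simp, by simpa using hb, ?_⟩
      convert this using 1
      simp; abel
    have hpi := Nat.prime_iff_prime_int.1 hp
    have hn : ∀ {x γ : ℤ}, Smooth p x → ¬ (p : ℤ) ∣ γ → ¬ (p : ℤ) ∣ x * γ ^ 2 := fun hx hγ hd =>
      (hpi.dvd_or_dvd hd).elim (hx.not_dvd hp) fun hd => hγ (hpi.dvd_of_dvd_pow hd)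
    have hA := smooth_emod hp (hn ha hα)
    have hN := smooth_emod hp (hc.neg.not_dvd hp)
    have hBmod : b * β ^ 2 ≡ (-c) % p - (a * α ^ 2) % p [ZMOD p] := by
      refine Int.ModEq.trans ?_ ((Int.mod_modEq _ _).symm.sub (Int.mod_modEq _ _).symm)
      refine (Int.modEq_iff_dvd.2 ?_).symm
      rwa [show b * β ^ 2 - (-c - a * α ^ 2) = a * α ^ 2 + b * β ^ 2 + c by ring]
    have hB : Smooth p ((-c) % p - (a * α ^ 2) % p) := by
      have hp' : (0 : ℤ) < p := by exact_mod_cast hp.pos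
      refine smooth_of_abs_lt ?_ ?_
      · intro h0
        rw [h0] at hBmod
        exact hn hb hβ (Int.modEq_zero_iff_dvd.1 hBmod)
      · have h1 := Int.emod_nonneg (-c) hp0
        have h2 := Int.emod_nonneg (a * α ^ 2) hp0
        have h3 := Int.emod_lt_of_pos (-c) hp'
        have h4 := Int.emod_lt_of_pos (a * α ^ 2) hp'
        rw [abs_lt]
        constructor <;> linarith
    have h1 := hg.sub_mem_of_modEq_mul_sq hp ha hA hα (Int.mod_modEq _ _).symm
    have h2 := hg.sub_mem_of_modEq_mul_sq hp hb hB hβ hBmod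
    have h3 := hg.sub_mem_of_modEq hp hc.neg hN (Int.mod_modEq _ _).symm
    rw [mul_neg, hg.neg _ (mul_ne_zero hp0 hc.1)] at h3
    generalize (a * α ^ 2) % p = r at *
    generalize (-c) % (p : ℤ) = n at *
    refine ⟨[r * (n - r) * n], by simp, by simpa using (hA.mul hB).mul hN, ?_⟩
    have h4 := hg.add (p * r) (p * (n - r)) (mul_ne_zero hp0 hA.1) (mul_ne_zero hp0 hB.1)
      (by rw [← mul_add, add_sub_cancel]; exact mul_ne_zero hp0 hN.1)
    rw [← mul_add, add_sub_cancel] at h4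
    have h5 : g (p * r * (p * (n - r)) * (p * n)) = g (p * (r * (n - r) * n)) := by
      rw [← hg.sq (p * (r * (n - r) * n)) p (mul_ne_zero hp0 ((hA.mul hB).mul hN).1) hp0]
      congr 1; ring
    rw [h5] at h4
    have h6 : g (p * a) + g (p * b) + g (p * c) -
        (List.map (fun e => g (p * e)) [r * (n - r) * n]).sum =
        (g (p * a) - g (p * r)) + (g (p * b) - g (p * (n - r))) - (-g (p * c) - g (p * n)) := by
      simp only [List.map_cons, List.map_nil, List.sum_cons, List.sum_nil, add_zero]
      rw [eq_sub_of_add_eq' h4.symm]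
      abel
    rw [h6]
    exact sub_mem (add_mem h1 h2) h3

theorem exists_list_of_mem_smoothSubgroup_succ {x : G} (hx : x ∈ smoothSubgroup g (p + 1)) :
    ∃ l : List ℤ, (∀ c ∈ l, Smooth p c) ∧
      x - (l.map fun c => g (p * c)).sum ∈ smoothSubgroup g p := by
  have hp0 : (p : ℤ) ≠ 0 := by exact_mod_cast hp.ne_zero
  induction hx using AddSubgroup.closure_induction with
  | mem x hx =>
    obtain ⟨a, ha, rfl⟩ := hx
    obtain ⟨c, hac, hnd⟩ := (Int.finiteMultiplicity_iff.2
      ⟨by simpa using hp.ne_one, ha.1⟩ : FiniteMultiplicity (p : ℤ) a).exists_eq_pow_mul_and_not_dvd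
    generalize multiplicity (p : ℤ) a = k at hac
    subst hac
    have hc : Smooth p c := by
      refine ⟨ha.of_mul_right.1, fun q hq hd => lt_of_le_of_ne
        (Nat.lt_succ_iff.1 (ha.of_mul_right.2 q hq hd)) ?_⟩
      rintro rfl
      exact hnd hd
    obtain ⟨m, rfl | rfl⟩ := k.even_or_odd'
    · refine ⟨[], by simp, ?_⟩
      rw [show (p : ℤ) ^ (2 * m) * c = c * ((p : ℤ) ^ m) ^ 2 by ring,
        hg.sq _ _ hc.1 (pow_ne_zero _ hp0)]
      simpa using mem_smoothSubgroup hc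
    · refine ⟨[c], by simpa using hc, ?_⟩
      rw [show (p : ℤ) ^ (2 * m + 1) * c = p * c * ((p : ℤ) ^ m) ^ 2 by ring,
        hg.sq _ _ (mul_ne_zero hp0 hc.1) (pow_ne_zero _ hp0)]
      simp
  | zero => exact ⟨[], by simp, by simp⟩
  | add x y _ _ hx hy =>
    obtain ⟨l, h1, h2⟩ := hx
    obtain ⟨l', h1', h2'⟩ := hy
    refine ⟨l ++ l', ?_, ?_⟩
    · intro c hc
      exact (List.mem_append.1 hc).elim (h1 c) (h1' c)
    · rw [List.map_append, List.sum_append, add_sub_add_comm]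
      exact add_mem h2 h2'
  | neg x _ hx =>
    obtain ⟨l, h1, h2⟩ := hx
    refine ⟨l.map Neg.neg, ?_, ?_⟩
    · intro c hc
      obtain ⟨c, hc', rfl⟩ := List.mem_map.1 hc
      exact (h1 c hc').neg
    · have : ((l.map Neg.neg).map fun c => g (p * c)).sum = -(l.map fun c => g (p * c)).sum := by
        clear h2
        induction l with
        | nil => simp
        | cons c l ih =>
          have hc : c ≠ 0 := (h1 c (by simp)).1
          simp only [List.map_cons, List.sum_cons, mul_neg, hg.neg _ (mul_ne_zero hp0 hc)] at ih ⊢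
          rw [ih fun e he => h1 e (by simp [he]), neg_add]
      rw [this, ← neg_sub', neg_mem_iff]
      exact h2

/-- Modulo the classes of smaller integers, an element is a sum of `g (p * cᵢ)` with `∑ cᵢ xᵢ²`
anisotropic modulo `p`. -/
theorem WittRelations.exists_anisotropic {x : G} (hx : x ∈ smoothSubgroup g (p + 1)) :
    ∃ (s : ℕ) (c : Fin s → ℤ), (∀ i, Smooth p (c i)) ∧
      (∀ α : Fin s → ℤ, (p : ℤ) ∣ ∑ i, c i * α i ^ 2 → ∀ i, (p : ℤ) ∣ α i) ∧
      x - ∑ i, g (p * c i) ∈ smoothSubgroup g p := by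
  have hpi := Nat.prime_iff_prime_int.1 hp
  obtain ⟨l, hl⟩ := exists_list_of_mem_smoothSubgroup_succ hg hp hx
  induction h : l.length using Nat.strong_induction_on generalizing l with
  | _ N ih =>
    obtain ⟨h1, h2⟩ := hl
    match l with
    | [] => exact ⟨0, Fin.elim0, fun i => i.elim0, fun _ _ i => i.elim0, by simpa using h2⟩
    | [c] =>
      have hc : Smooth p c := h1 c (by simp)
      refine ⟨1, fun _ => c, fun _ => hc, ?_, by simpa using h2⟩
      intro α hα i
      rw [Fin.sum_univ_one] at hα
      rw [Subsingleton.elim i 0]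
      exact hpi.dvd_of_dvd_pow ((hpi.dvd_or_dvd hα).resolve_left (hc.not_dvd hp))
    | [c, c'] =>
      have hc : Smooth p c := h1 c (by simp)
      have hc' : Smooth p c' := h1 c' (by simp)
      by_cases hiso : ∃ α β : ℤ, ¬ (p : ℤ) ∣ α ∧ ¬ (p : ℤ) ∣ β ∧ (p : ℤ) ∣ c * α ^ 2 + c' * β ^ 2
      · obtain ⟨α, β, hα, hβ, hd⟩ := hiso
        refine ih 0 (by simp [← h]) [] ⟨by simp, ?_⟩ rfl
        have := add_mem h2 (hg.add_mem_of_isotropic hp hc hc' hα hβ hd)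
        simpa using this
      · push Not at hiso
        refine ⟨2, ![c, c'], ?_, ?_, by simpa using h2⟩
        · intro i
          fin_cases i
          · exact hc
          · exact hc'
        · intro α hα
          simp only [Fin.sum_univ_two, Matrix.cons_val_zero, Matrix.cons_val_one] at hα
          have h3 : (p : ℤ) ∣ α 0 ∧ (p : ℤ) ∣ α 1 := by
            by_cases h0 : (p : ℤ) ∣ α 0
            · refine ⟨h0, ?_⟩
              have h4 := (dvd_add_right ((h0.pow two_ne_zero).mul_left c)).1 hα
              exact hpi.dvd_of_dvd_pow ((hpi.dvd_or_dvd h4).resolve_left (hc'.not_dvd hp))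
            · by_cases h1 : (p : ℤ) ∣ α 1
              · have h4 := (dvd_add_left ((h1.pow two_ne_zero).mul_left c')).1 hα
                exact absurd (hpi.dvd_of_dvd_pow
                  ((hpi.dvd_or_dvd h4).resolve_left (hc.not_dvd hp))) h0
              · exact absurd hα (hiso _ _ h0 h1)
          intro i
          fin_cases i
          · exact h3.1
          · exact h3.2
    | a :: b :: c :: l =>
      obtain ⟨l', hl', hs, hm⟩ := hg.exists_triple hp (h1 a (by simp)) (h1 b (by simp))
        (h1 c (by simp))
      refine ih (l' ++ l).length ?_ (l' ++ l) ⟨?_, ?_⟩ rfl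
      · simp at h ⊢
        omega
      · intro e he
        rcases List.mem_append.1 he with he | he
        · exact hs e he
        · exact h1 e (by simp [he])
      · have := add_mem h2 hm
        convert this using 1
        simp
        abel

omit hp

theorem WittRelations.eq_zero_of_mem {x : G} (hx : x ∈ smoothSubgroup g 2) : x = 0 := by
  have : smoothSubgroup g 2 ≤ ⊥ := by
    refine (AddSubgroup.closure_le _).2 ?_
    rintro _ ⟨a, ha, rfl⟩
    rcases ha.eq_one_or with rfl | rfl
    · exact hg.one
    · change g (-1) = 0
      rw [hg.neg 1 one_ne_zero, hg.one, neg_zero]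
  exact this hx

theorem WittRelations.exists_sum_eq {p : ℕ} {x : G} (hx : x ∈ smoothSubgroup g p) :
    ∃ (k : ℕ) (b : Fin k → ℤ), (∀ i, Smooth p (b i)) ∧ x = ∑ i, g (b i) := by
  induction hx using AddSubgroup.closure_induction with
  | mem x hx =>
    obtain ⟨a, ha, rfl⟩ := hx
    exact ⟨1, fun _ => a, fun _ => ha, by simp⟩
  | zero => exact ⟨0, Fin.elim0, fun i => i.elim0, by simp⟩
  | add x y _ _ hx hy =>
    obtain ⟨k, b, h1, rfl⟩ := hx
    obtain ⟨k', b', h1', rfl⟩ := hy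
    refine ⟨k + k', Fin.append b b', fun i => ?_, ?_⟩
    · induction i using Fin.addCases with
      | left i => simpa using h1 i
      | right i => simpa using h1' i
    · simp [Fin.sum_univ_add]
  | neg x _ hx =>
    obtain ⟨k, b, h1, rfl⟩ := hx
    refine ⟨k, fun i => -b i, fun i => (h1 i).neg, ?_⟩
    rw [← Finset.sum_neg_distrib]
    exact Finset.sum_congr rfl fun i _ => (hg.neg _ (h1 i).1).symm

omit hg in
theorem smoothSubgroup_succ_le {p : ℕ} (hp : ¬ p.Prime) :
    smoothSubgroup g (p + 1) ≤ smoothSubgroup g p :=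
  AddSubgroup.closure_mono fun _ ⟨a, ha, h⟩ => ⟨a, ha.of_succ hp, h⟩

end Residue
section StableClass

/-- Stable congruence on rational square matrices. -/
def stabSetoid : Setoid (Σ n : ℕ, Matrix (Fin n) (Fin n) ℚ) where
  r A B := Stab A.2 B.2
  iseqv := ⟨fun A => Stab.refl A.2, Stab.symm, Stab.trans⟩

/-- Stable congruence classes of rational square matrices. -/
def StableClass : Type := Quotient stabSetoid

namespace StableClass

variable {ι κ : Type*} [Fintype ι] [Fintype κ] [DecidableEq ι] [DecidableEq κ]

/-- The stable class of a rational square matrix. -/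
noncomputable def mk (A : Matrix ι ι ℚ) : StableClass :=
  Quotient.mk stabSetoid
    ⟨Fintype.card ι, A.submatrix (Fintype.equivFin ι).symm (Fintype.equivFin ι).symm⟩

theorem mk_eq_mk {A : Matrix ι ι ℚ} {B : Matrix κ κ ℚ} : mk A = mk B ↔ Stab A B := by
  have hA := (Cong.submatrix A (Fintype.equivFin ι).symm).stab
  have hB := (Cong.submatrix B (Fintype.equivFin κ).symm).stab
  refine (Quotient.eq (r := stabSetoid)).trans ?_
  exact ⟨fun h => hA.trans (Stab.trans h hB.symm), fun h => hA.symm.trans (h.trans hB)⟩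

theorem mk_sigma (A : Σ n : ℕ, Matrix (Fin n) (Fin n) ℚ) :
    mk A.2 = Quotient.mk stabSetoid A := by
  exact Quotient.sound (Cong.submatrix A.2 (Fintype.equivFin _).symm).symm.stab

theorem exists_mk (x : StableClass) : ∃ (n : ℕ) (A : Matrix (Fin n) (Fin n) ℚ), mk A = x := by
  induction x using Quotient.ind with
  | _ A => exact ⟨A.1, A.2, mk_sigma A⟩

noncomputable instance : Zero StableClass := ⟨mk (0 : Matrix (Fin 0) (Fin 0) ℚ)⟩

noncomputable instance : Add StableClass :=
  ⟨Quotient.map₂ (fun A B => ⟨Fintype.card (Fin A.1 ⊕ Fin B.1), (osum A.2 B.2).submatrix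
    (Fintype.equivFin _).symm (Fintype.equivFin _).symm⟩) fun _ _ hA _ _ hB =>
      (Cong.submatrix _ _).symm.stab.trans ((Stab.osum hA hB).trans (Cong.submatrix _ _).stab)⟩

theorem zero_def : (0 : StableClass) = mk (0 : Matrix (Fin 0) (Fin 0) ℚ) := rfl

theorem mk_osum (A : Matrix ι ι ℚ) (B : Matrix κ κ ℚ) : mk (osum A B) = mk A + mk B := by
  have h : mk A + mk B = mk (osum
    (A.submatrix (Fintype.equivFin ι).symm (Fintype.equivFin ι).symm)
    (B.submatrix (Fintype.equivFin κ).symm (Fintype.equivFin κ).symm)) := rfl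
  rw [h, mk_eq_mk]
  exact ((Cong.submatrix A _).osum (Cong.submatrix B _)).stab

noncomputable instance : AddCommMonoid StableClass where
  add_assoc x y z := by
    obtain ⟨_, A, rfl⟩ := exists_mk x
    obtain ⟨_, B, rfl⟩ := exists_mk y
    obtain ⟨_, C, rfl⟩ := exists_mk z
    simp only [← mk_osum]
    exact mk_eq_mk.2 (osum_assoc A B C).stab
  zero_add x := by
    obtain ⟨_, A, rfl⟩ := exists_mk x
    rw [zero_def, ← mk_osum, mk_eq_mk]
    exact ((osum_comm _ _).trans (osum_empty _ _)).stab
  add_zero x := by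
    obtain ⟨_, A, rfl⟩ := exists_mk x
    rw [zero_def, ← mk_osum, mk_eq_mk]
    exact (osum_empty _ _).stab
  add_comm x y := by
    obtain ⟨_, A, rfl⟩ := exists_mk x
    obtain ⟨_, B, rfl⟩ := exists_mk y
    rw [← mk_osum, ← mk_osum, mk_eq_mk]
    exact (osum_comm A B).stab
  nsmul := nsmulRec

theorem mk_eq_zero {A : Matrix ι ι ℚ} : mk A = 0 ↔ StabTriv A := by
  rw [zero_def, mk_eq_mk]
  rfl

/-- The rank one form `⟨a⟩`. -/
def rankOne (a : ℚ) : Matrix Unit Unit ℚ := diagonal fun _ => a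

theorem rankOne_cong_sq (a : ℚ) {b : ℚ} (hb : b ≠ 0) : Cong (rankOne (a * b ^ 2)) (rankOne a) := by
  refine ⟨rankOne b⁻¹, rankOne b, ?_, ?_, ?_⟩
  · simp [rankOne, hb]
  · simp [rankOne, hb]
  · simp only [rankOne, diagonal_transpose, diagonal_mul_diagonal]
    congr 1
    ext
    field_simp

theorem rankOne_osum_cong {a b c d : ℚ} (x y z w : ℚ) (h : x * w - y * z ≠ 0)
    (h1 : a * x ^ 2 + b * z ^ 2 = c) (h2 : a * x * y + b * z * w = 0)
    (h3 : a * y ^ 2 + b * w ^ 2 = d) :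
    Cong (osum (rankOne a) (rankOne b)) (osum (rankOne c) (rankOne d)) := by
  have hQP : fromBlocks (rankOne (w / (x * w - y * z))) (rankOne (-y / (x * w - y * z)))
      (rankOne (-z / (x * w - y * z))) (rankOne (x / (x * w - y * z))) *
      fromBlocks (rankOne x) (rankOne y) (rankOne z) (rankOne w) = 1 := by
    have e1 : w / (x * w - y * z) * x + -y / (x * w - y * z) * z = 1 := by
      rw [div_mul_eq_mul_div, div_mul_eq_mul_div, ← add_div, div_eq_one_iff_eq h]; ring
    have e2 : w / (x * w - y * z) * y + -y / (x * w - y * z) * w = 0 := by ring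
    have e3 : -z / (x * w - y * z) * x + x / (x * w - y * z) * z = 0 := by ring
    have e4 : -z / (x * w - y * z) * y + x / (x * w - y * z) * w = 1 := by
      rw [div_mul_eq_mul_div, div_mul_eq_mul_div, ← add_div, div_eq_one_iff_eq h]; ring
    rw [fromBlocks_multiply, ← fromBlocks_one]
    simp only [rankOne, diagonal_mul_diagonal, diagonal_add, e1, e2, e3, e4, diagonal_one,
      diagonal_zero]
  refine ⟨_, _, mul_eq_one_comm.1 hQP, hQP, ?_⟩
  · rw [fromBlocks_transpose, osum, osum, fromBlocks_multiply, fromBlocks_multiply]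
    simp only [rankOne, diagonal_mul_diagonal, diagonal_add, ← diagonal_zero, diagonal_transpose]
    congr 2 <;> ext <;> simp <;> linarith

theorem rankOne_one_cong : Cong (rankOne 1) (1 : Matrix (Fin 1) (Fin 1) ℚ) := by
  convert Cong.submatrix (rankOne 1) (Equiv.equivPUnit (Fin 1))
  simp [rankOne]

theorem rankOne_neg_one_cong : Cong (rankOne (-1)) (-1 : Matrix (Fin 1) (Fin 1) ℚ) := by
  convert Cong.submatrix (rankOne (-1)) (Equiv.equivPUnit (Fin 1))
  ext i j
  rw [Subsingleton.elim i 0, Subsingleton.elim j 0]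
  simp [rankOne]

theorem mk_rankOne_add_neg {a : ℚ} (ha : a ≠ 0) : mk (rankOne a) + mk (rankOne (-a)) = 0 := by
  rw [← mk_osum, mk_eq_zero]
  have h : Cong (osum (rankOne a) (rankOne (-a))) (osum (rankOne 1) (rankOne (-1))) := by
    refine rankOne_osum_cong (1 + (4 * a)⁻¹) (1 - (4 * a)⁻¹) (1 - (4 * a)⁻¹) (1 + (4 * a)⁻¹)
      ?_ ?_ ?_ ?_
    · have : (1 + (4 * a)⁻¹) * (1 + (4 * a)⁻¹) - (1 - (4 * a)⁻¹) * (1 - (4 * a)⁻¹) = a⁻¹ := by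
        field_simp; ring
      rw [this]
      exact inv_ne_zero ha
    · field_simp; ring
    · field_simp; ring
    · field_simp; ring
  exact (h.trans (rankOne_one_cong.osum rankOne_neg_one_cong)).stab.trans (stabTriv_sgn 1 1)

/-- The invertible class of the rank one form `⟨a⟩`, `a ≠ 0`. -/
noncomputable def unitOf (a : ℤ) : AddUnits StableClass :=
  if h : (a : ℚ) ≠ 0 then
    ⟨mk (rankOne a), mk (rankOne (-a)), mk_rankOne_add_neg h, by
      rw [add_comm]; exact mk_rankOne_add_neg h⟩
  else 0

theorem val_unitOf {a : ℤ} (ha : a ≠ 0) : (unitOf a : StableClass) = mk (rankOne a) := by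
  have h : (a : ℚ) ≠ 0 := by exact_mod_cast ha
  simp [unitOf, ha]

theorem wittRelations_unitOf : WittRelations unitOf where
  sq a b ha hb := by
    apply AddUnits.ext
    rw [val_unitOf ha, val_unitOf (mul_ne_zero ha (pow_ne_zero 2 hb)), mk_eq_mk]
    push_cast
    exact (rankOne_cong_sq _ (by exact_mod_cast hb)).stab
  neg a ha := by
    rw [eq_neg_iff_add_eq_zero]
    apply AddUnits.ext
    rw [AddUnits.val_add, val_unitOf ha, val_unitOf (neg_ne_zero.2 ha), add_comm]
    push_cast
    exact mk_rankOne_add_neg (by exact_mod_cast ha)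
  one := by
    apply AddUnits.ext
    rw [val_unitOf one_ne_zero, AddUnits.val_zero, mk_eq_zero]
    push_cast
    exact (rankOne_one_cong.trans (cong_one_sgn 1)).stab.trans (stabTriv_sgn 1 0)
  add a b ha hb hab := by
    apply AddUnits.ext
    rw [AddUnits.val_add, AddUnits.val_add, val_unitOf ha, val_unitOf hb, val_unitOf hab,
      val_unitOf (mul_ne_zero (mul_ne_zero ha hb) hab), ← mk_osum, ← mk_osum, mk_eq_mk]
    push_cast
    have hab' : (a : ℚ) + b ≠ 0 := by exact_mod_cast hab
    refine (rankOne_osum_cong 1 b 1 (-a) ?_ ?_ ?_ ?_).stab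
    · intro h
      apply hab'
      linarith
    all_goals ring

theorem mk_diagonal {k : ℕ} (b : Fin k → ℚ) : mk (diagonal b) = ∑ i, mk (rankOne (b i)) := by
  induction k with
  | zero =>
    rw [Fin.sum_univ_zero, mk_eq_zero]
    exact (Cong.of_eq (Subsingleton.elim _ _)).stab
  | succ k ih =>
    rw [Fin.sum_univ_succ, ← ih fun i => b i.succ, add_comm (mk _), ← mk_osum, mk_eq_mk]
    refine Cong.stab ?_
    convert Cong.submatrix (diagonal b)
      ((finSuccEquiv k).trans (Equiv.optionEquivSumPUnit (Fin k))).symm using 1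
    ext (i | i) (j | j) <;> simp [diagonal_apply, rankOne]
    exact fun h => absurd h.symm (Fin.succ_ne_zero _)

theorem sum_val_unitOf {k : ℕ} {b : Fin k → ℤ} (hb : ∀ i, b i ≠ 0) :
    ((∑ i, unitOf (b i) : AddUnits StableClass) : StableClass) = mk (castQ (diagonal b)) := by
  have h : castQ (diagonal b) = diagonal fun i => (b i : ℚ) := by
    simp [castQ, diagonal_map]
  rw [h, mk_diagonal, ← AddUnits.coeHom_apply, map_sum]
  exact Finset.sum_congr rfl fun i _ => val_unitOf (hb i)

theorem exists_mk_eq_sum {A : Matrix ι ι ℚ} (hA : A.IsSymm) (hdet : A.det ≠ 0) :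
    ∃ (k : ℕ) (b : Fin k → ℤ), (∀ i, b i ≠ 0) ∧
      mk A = ((∑ i, unitOf (b i) : AddUnits StableClass) : StableClass) := by
  have hs : LinearMap.IsSymm (Matrix.toBilin' A) :=
    LinearMap.BilinForm.isSymm_iff.1 (Matrix.isSymm_toBilin'_iff_isSymm.2 hA)
  obtain ⟨v, hv⟩ := LinearMap.BilinForm.exists_orthogonal_basis hs
  let c := Pi.basisFun ℚ ι
  have hcong : Cong A ((c.toMatrix v)ᵀ * A * c.toMatrix v) := by
    refine ⟨c.toMatrix v, v.toMatrix c, ?_, ?_, rfl⟩ <;>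
    rw [Module.Basis.toMatrix_mul_toMatrix, Module.Basis.toMatrix_self]
  have hent : ∀ i j, ((c.toMatrix v)ᵀ * A * c.toMatrix v) i j = Matrix.toBilin' A (v i) (v j) := by
    intro i j
    rw [Matrix.toBilin'_apply', Matrix.mul_assoc, Matrix.mul_apply, dotProduct]
    refine Finset.sum_congr rfl fun l _ => ?_
    rw [Matrix.mul_apply, mulVec, dotProduct]
    simp [c, Module.Basis.toMatrix_apply]
  have hdiag : (c.toMatrix v)ᵀ * A * c.toMatrix v =
      diagonal fun i => Matrix.toBilin' A (v i) (v i) := by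
    ext i j
    rw [hent]
    by_cases h : i = j
    · simp [h]
    · rw [diagonal_apply_ne _ h]
      exact hv h
  rw [hdiag] at hcong
  have hne : ∀ i, Matrix.toBilin' A (v i) (v i) ≠ 0 := by
    obtain ⟨u, hu⟩ := hcong.exists_det_eq
    rw [det_diagonal] at hu
    have h0 : ∏ i, Matrix.toBilin' A (v i) (v i) ≠ 0 := by
      rw [hu]; exact mul_ne_zero u.ne_zero hdet
    exact fun i => Finset.prod_ne_zero_iff.1 h0 i (Finset.mem_univ i)
  generalize hd : (fun i => Matrix.toBilin' A (v i) (v i)) = d at hcong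
  have hd0 : ∀ i, d i ≠ 0 := fun i => by rw [← hd]; exact hne i
  have hb : ∀ i, (d i).num * (d i).den ≠ 0 := fun i =>
    mul_ne_zero (Rat.num_ne_zero.2 (hd0 i)) (by exact_mod_cast (d i).den_ne_zero)
  refine ⟨_, fun i => (d i).num * (d i).den, hb, ?_⟩
  rw [mk_eq_mk.2 hcong.stab, mk_diagonal, ← AddUnits.coeHom_apply, map_sum]
  refine Finset.sum_congr rfl fun i _ => ?_
  rw [AddUnits.coeHom_apply, val_unitOf (hb i), mk_eq_mk]
  have hden : ((d i).den : ℚ) ≠ 0 := by exact_mod_cast (d i).den_ne_zero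
  have h2 : (((d i).num * (d i).den : ℤ) : ℚ) = d i * (d i).den ^ 2 := by
    conv_rhs => rw [← Rat.num_div_den (d i)]
    rw [Rat.num_div_den]
    push_cast
    have := Rat.mul_den_eq_num (d i)
    rw [← this]; ring
  rw [h2]
  exact (rankOne_cong_sq _ hden).symm.stab

end StableClass

end StableClass
section Anisotropic

/-- A finitely generated full subgroup of `ℚⁿ` is separated from any vector outside it by a
functional with integral values on it. -/
theorem exists_dotProduct_separating {κ : Type*} [Fintype κ] [DecidableEq κ]
    (Γ : Submodule ℤ (κ → ℚ)) [Module.Finite ℤ Γ] (hΓ : ∀ k, Pi.single k 1 ∈ Γ) {v : κ → ℚ}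
    (hv : v ∉ Γ) :
    ∃ w : κ → ℚ, (∀ x ∈ Γ, ∃ n : ℤ, w ⬝ᵥ x = n) ∧ ¬ ∃ n : ℤ, w ⬝ᵥ v = n := by
  let b := Module.finBasis ℤ Γ
  have hli : LinearIndependent ℚ fun i => (b i : κ → ℚ) := by
    rw [← LinearIndependent.iff_fractionRing ℤ ℚ]
    exact b.linearIndependent.map' Γ.subtype Γ.ker_subtype
  have hmemΓ : ∀ x ∈ Γ, ∃ n : Fin (Module.finrank ℤ Γ) → ℤ, x = ∑ i, (n i : ℚ) • (b i : κ → ℚ) := by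
    intro x hx
    refine ⟨b.repr ⟨x, hx⟩, ?_⟩
    have h := congrArg Subtype.val (b.sum_repr ⟨x, hx⟩)
    rw [Submodule.coe_sum] at h
    refine h.symm.trans (Finset.sum_congr rfl fun i _ => ?_)
    rw [Int.cast_smul_eq_zsmul]
    rfl
  have hsp : ⊤ ≤ Submodule.span ℚ (Set.range fun i => (b i : κ → ℚ)) := by
    rw [← (Pi.basisFun ℚ κ).span_eq, Submodule.span_le]
    rintro _ ⟨k, rfl⟩
    rw [Pi.basisFun_apply]
    obtain ⟨n, hn⟩ := hmemΓ _ (hΓ k)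
    rw [hn]
    exact Submodule.sum_mem _ fun i _ => Submodule.smul_mem _ _ (Submodule.subset_span ⟨i, rfl⟩)
  let b' := Module.Basis.mk hli hsp
  have hb' : ∀ i, b' i = (b i : κ → ℚ) := fun i => Module.Basis.mk_apply hli hsp i
  have hcoord : ∀ i x, (fun k => b'.repr (Pi.single k 1) i) ⬝ᵥ x = b'.repr x i := by
    intro i x
    conv_rhs => rw [← (Pi.basisFun ℚ κ).sum_repr x]
    simp [dotProduct, mul_comm]
  have hex : ∃ i, ¬ ∃ n : ℤ, b'.repr v i = n := by
    by_contra! hcon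
    choose n hn using hcon
    refine hv ?_
    rw [← b'.sum_repr v]
    refine Submodule.sum_mem _ fun i _ => ?_
    rw [hn, hb', Int.cast_smul_eq_zsmul]
    exact Γ.smul_mem _ (b i).2
  obtain ⟨i, hi⟩ := hex
  refine ⟨fun k => b'.repr (Pi.single k 1) i, fun x hx => ?_, by rwa [hcoord]⟩
  rw [hcoord]
  obtain ⟨n, rfl⟩ := hmemΓ x hx
  refine ⟨n i, ?_⟩
  simp only [← hb', map_sum, map_smul, Module.Basis.repr_self]
  simp [Finsupp.single_apply]

variable {ι τ : Type*} [Fintype ι] [Fintype τ] [DecidableEq ι] [DecidableEq τ]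

/-- A rational form with a unimodular lattice has no part `p ∑ cᵢ xᵢ²` with `∑ cᵢ xᵢ²` anisotropic
modulo `p`. -/
theorem isEmpty_of_anisotropic {p : ℕ} (hp : p.Prime) {U : Matrix ι ι ℤ}
    (hUu : IsUnit U.det) {E₀ : Matrix τ τ ℤ} (hdet : ¬ (p : ℤ) ∣ E₀.det) {s : ℕ}
    {c : Fin s → ℤ} (hc : ∀ i, ¬ (p : ℤ) ∣ c i)
    (haniso : ∀ α : Fin s → ℤ, (p : ℤ) ∣ ∑ i, c i * α i ^ 2 → ∀ i, (p : ℤ) ∣ α i)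
    (h : Cong (castQ U) (castQ (osum E₀ (diagonal fun i => p * c i)))) : IsEmpty (Fin s) := by
  refine ⟨fun j₀ => ?_⟩
  have hpi := Nat.prime_iff_prime_int.1 hp
  have hpQ : (p : ℚ) ≠ 0 := by exact_mod_cast hp.ne_zero
  set E := osum E₀ (diagonal fun i => p * c i) with hE
  obtain ⟨P, Q, h1, h2, h3⟩ := h
  have hEQ : castQ E * Q = Pᵀ * castQ U := by
    rw [← h3, Matrix.mul_assoc, h1, Matrix.mul_one]
  have hQEQ : Qᵀ * castQ E * Q = castQ U := by
    rw [Matrix.mul_assoc, hEQ, ← Matrix.mul_assoc, ← transpose_mul, h1, transpose_one,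
      Matrix.one_mul]
  set d : ℤ := E₀.det * ∏ i, c i with hd
  have hpd : ¬ (p : ℤ) ∣ d := by
    intro hpd
    rcases hpi.dvd_or_dvd hpd with h | h
    · exact hdet h
    · obtain ⟨i, -, hi⟩ := (hpi.dvd_finsetProd_iff _).1 h
      exact hc i hi
  have hEinl : ∀ (w : τ ⊕ Fin s → ℚ) (t : τ),
      (castQ E *ᵥ w) (Sum.inl t) = (castQ E₀ *ᵥ (w ∘ Sum.inl)) t := by
    intro w t
    rw [hE, castQ_osum, osum, fromBlocks_mulVec]
    simp
  have hEinr : ∀ (w : τ ⊕ Fin s → ℚ) (j : Fin s),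
      (castQ E *ᵥ w) (Sum.inr j) = p * c j * w (Sum.inr j) := by
    intro w j
    rw [hE, castQ_osum, osum, fromBlocks_mulVec]
    have : castQ (diagonal fun i => (p : ℤ) * c i) = diagonal fun i => (p : ℚ) * c i := by
      simp [castQ, diagonal_map]
    simp [this, mulVec_diagonal]
  have claim : ∀ (z : ι → ℤ) (y : τ ⊕ Fin s → ℤ), castQ E *ᵥ (Q *ᵥ vecRat z) = vecRat y →
      ∃ x : τ ⊕ Fin s → ℤ, (d : ℚ) • (Q *ᵥ vecRat z) = vecRat x := by
    intro z y hy
    have hN : (Q *ᵥ vecRat z) ⬝ᵥ (castQ E *ᵥ (Q *ᵥ vecRat z)) = ((z ⬝ᵥ (U *ᵥ z) : ℤ) : ℚ) := by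
      have e : castQ U *ᵥ vecRat z = Qᵀ *ᵥ (castQ E *ᵥ (Q *ᵥ vecRat z)) := by
        rw [← hQEQ, mulVec_mulVec, mulVec_mulVec]
      calc (Q *ᵥ vecRat z) ⬝ᵥ (castQ E *ᵥ (Q *ᵥ vecRat z))
          = vecRat z ⬝ᵥ (Qᵀ *ᵥ (castQ E *ᵥ (Q *ᵥ vecRat z))) := by
            rw [dotProduct_mulVec (vecRat z), vecMul_transpose]
        _ = vecRat z ⬝ᵥ vecRat (U *ᵥ z) := by rw [← e, castQ_mulVec_vecRat]
        _ = _ := by simp [dotProduct, vecRat]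
    generalize Q *ᵥ vecRat z = w at hy hN ⊢
    have hinl : (E₀.det : ℚ) • (w ∘ Sum.inl) = vecRat (E₀.adjugate *ᵥ (y ∘ Sum.inl)) := by
      have h4 : castQ E₀ *ᵥ (w ∘ Sum.inl) = vecRat (y ∘ Sum.inl) := by
        ext t
        rw [← hEinl, hy]
        rfl
      have h5 : castQ (E₀.det • (1 : Matrix τ τ ℤ)) = (E₀.det : ℚ) • 1 := by
        rw [← castQ_one]
        ext i j
        simp only [castQ, Matrix.map_apply, Matrix.smul_apply, smul_eq_mul, map_mul]
        rfl
      rw [← castQ_mulVec_vecRat, ← h4, mulVec_mulVec, ← castQ_mul, adjugate_mul, h5, smul_mulVec,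
        one_mulVec]
    have hinr : ∀ j, (p : ℚ) * c j * w (Sum.inr j) = y (Sum.inr j) := fun j => by
      rw [← hEinr, hy]
      rfl
    have hcd : ∀ j, c j ∣ d := fun j => (Finset.dvd_prod_of_mem c (Finset.mem_univ j)).mul_left _
    choose e he using hcd
    have hα : ∀ j, (p : ℚ) * (d * w (Sum.inr j)) = ((e j * y (Sum.inr j) : ℤ) : ℚ) := fun j => by
      push_cast
      rw [← hinr j, he j]
      push_cast
      ring
    obtain ⟨a, ha⟩ : ∃ a : τ → ℤ, ∀ t, (d : ℚ) * w (Sum.inl t) = a t := by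
      refine ⟨fun t => (∏ i, c i) * (E₀.adjugate *ᵥ (y ∘ Sum.inl)) t, fun t => ?_⟩
      have h6 : (E₀.det : ℚ) * w (Sum.inl t) = ((E₀.adjugate *ᵥ (y ∘ Sum.inl)) t : ℤ) :=
        congrFun hinl t
      rw [hd]
      push_cast at h6 ⊢
      rw [← h6]
      ring
    have hsum : ∑ j, c j * (e j * y (Sum.inr j)) ^ 2 =
        p * (d ^ 2 * (z ⬝ᵥ (U *ᵥ z)) - d * ∑ t, a t * y (Sum.inl t)) := by
      have hsumQ : ∑ j, (c j : ℚ) * ((e j * y (Sum.inr j) : ℤ) : ℚ) ^ 2 =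
          p * (d ^ 2 * ((z ⬝ᵥ (U *ᵥ z) : ℤ) : ℚ) - d * ∑ t, (a t : ℚ) * y (Sum.inl t)) := by
        rw [← hN, hy, dotProduct, Fintype.sum_sum_type, mul_add, Finset.mul_sum, Finset.mul_sum,
          Finset.mul_sum, add_comm, add_sub_assoc, ← Finset.sum_sub_distrib, mul_add,
          Finset.mul_sum, Finset.mul_sum]
        have h7 : ∑ t, (p : ℚ) * ((d : ℚ) ^ 2 * (w (Sum.inl t) * vecRat y (Sum.inl t)) -
            d * (a t * y (Sum.inl t))) = 0 := by
          refine Finset.sum_eq_zero fun t _ => ?_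
          rw [← ha, vecRat]
          ring
        rw [h7, add_zero]
        refine Finset.sum_congr rfl fun j _ => ?_
        rw [← hα, vecRat, ← hinr]
        ring
      exact_mod_cast hsumQ
    have hdvd := haniso (fun j => e j * y (Sum.inr j)) (Dvd.intro _ hsum.symm)
    choose x hx using hdvd
    refine ⟨Sum.elim a x, ?_⟩
    ext (t | j)
    · simpa [vecRat] using ha t
    · have h8 := hα j
      rw [hx j] at h8
      push_cast at h8
      simpa [vecRat] using mul_left_cancel₀ hpQ h8
  let Λ : Submodule ℤ (τ ⊕ Fin s → ℚ) :=
    Submodule.span ℤ (Set.range fun i => Q *ᵥ Pi.single i 1)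
  let Z : Submodule ℤ (τ ⊕ Fin s → ℚ) :=
    Submodule.span ℤ (Set.range fun i => Pi.single i 1)
  have hΛ : ∀ x, x ∈ Λ ↔ ∃ z : ι → ℤ, x = Q *ᵥ vecRat z := by
    have hcol : ∀ z : ι → ℤ, Q *ᵥ vecRat z = ∑ i, z i • Q *ᵥ Pi.single i 1 := by
      intro z
      ext k
      simp [mulVec, dotProduct, vecRat, Finset.sum_apply, mul_comm]
    intro x
    rw [Submodule.mem_span_range_iff_exists_fun]
    simp only [hcol, eq_comm]
  have hZ : ∀ x, x ∈ Z ↔ ∃ z : τ ⊕ Fin s → ℤ, x = vecRat z := by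
    have hcol : ∀ z : τ ⊕ Fin s → ℤ, vecRat z = ∑ i, z i • Pi.single i (1 : ℚ) := by
      intro z
      ext k
      simp [vecRat, Finset.sum_apply, Pi.single_apply]
    intro x
    rw [Submodule.mem_span_range_iff_exists_fun]
    simp only [hcol, eq_comm]
  have : Module.Finite ℤ (Λ ⊔ Z : Submodule ℤ (τ ⊕ Fin s → ℚ)) :=
    Module.Finite.iff_fg.2 ((Submodule.fg_span (Set.finite_range _)).sup
      (Submodule.fg_span (Set.finite_range _)))
  let v : τ ⊕ Fin s → ℚ := Pi.single (Sum.inr j₀) ((d : ℚ) / p)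
  by_cases hv : v ∈ Λ ⊔ Z
  · obtain ⟨l, hl, n, hn, hln⟩ := Submodule.mem_sup.1 hv
    obtain ⟨z, rfl⟩ := (hΛ l).1 hl
    obtain ⟨n, rfl⟩ := (hZ n).1 hn
    have hlv : Q *ᵥ vecRat z = v - vecRat n := by rw [← hln]; simp
    have hEv : castQ E *ᵥ v = vecRat (Pi.single (Sum.inr j₀) (c j₀ * d)) := by
      ext (t | j)
      · rw [hEinl]
        have : v ∘ Sum.inl = 0 := by ext; simp [v]
        rw [this, mulVec_zero]
        simp [vecRat]
      · rw [hEinr]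
        by_cases hj : j = j₀
        · subst hj
          simp [v, vecRat]
          field_simp
        · simp [v, vecRat, hj]
    obtain ⟨x, hx⟩ := claim z (Pi.single (Sum.inr j₀) (c j₀ * d) - E *ᵥ n) (by
      rw [hlv, mulVec_sub, hEv, castQ_mulVec_vecRat]
      ext
      simp [vecRat])
    rw [hlv] at hx
    have hx0 := congrFun hx (Sum.inr j₀)
    simp only [Pi.smul_apply, Pi.sub_apply, v, Pi.single_eq_same, vecRat, smul_eq_mul] at hx0
    have hdd : d * d = p * (x (Sum.inr j₀) + d * n (Sum.inr j₀)) := by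
      have : (d : ℚ) * d = p * (x (Sum.inr j₀) + d * n (Sum.inr j₀)) := by
        rw [← hx0]
        field_simp
        ring
      exact_mod_cast this
    exact (hpi.dvd_or_dvd (Dvd.intro _ hdd.symm)).elim hpd hpd
  · obtain ⟨w, hw, hwv⟩ := exists_dotProduct_separating (Λ ⊔ Z)
      (fun k => Submodule.mem_sup_right (Submodule.subset_span ⟨k, rfl⟩)) hv
    choose y hy using fun k => hw _ (Submodule.mem_sup_right (Submodule.subset_span ⟨k, rfl⟩))
    choose n hn using fun i => hw _ (Submodule.mem_sup_left (Submodule.subset_span ⟨i, rfl⟩))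
    have hwy : w = vecRat y := by
      ext k
      rw [vecRat, ← hy k]
      simp
    have hQw : Qᵀ *ᵥ w = vecRat n := by
      ext i
      rw [vecRat, ← hn i, dotProduct_mulVec, mulVec_transpose]
      simp
    have hEw : castQ E *ᵥ (Q *ᵥ vecRat (U⁻¹ *ᵥ n)) = w := by
      rw [mulVec_mulVec, hEQ, ← mulVec_mulVec, castQ_mulVec_vecRat, mulVec_mulVec n,
        mul_nonsing_inv _ hUu, one_mulVec, ← hQw, mulVec_mulVec, ← transpose_mul, h2,
        transpose_one, one_mulVec]
    obtain ⟨x, hx⟩ := claim (U⁻¹ *ᵥ n) y (hEw.trans hwy)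
    refine hwv ⟨c j₀ * x (Sum.inr j₀), ?_⟩
    have hx0 := congrFun hx (Sum.inr j₀)
    have hw0 := congrFun hEw (Sum.inr j₀)
    rw [hEinr] at hw0
    simp only [Pi.smul_apply, vecRat, smul_eq_mul] at hx0
    push_cast
    rw [← hx0, dotProduct_single, ← hw0]
    field_simp

end Anisotropic
section Main

variable {ι κ : Type*} [Fintype ι] [Fintype κ] [DecidableEq ι] [DecidableEq κ]

open StableClass in
theorem mem_smoothSubgroup_of_succ {U : Matrix ι ι ℤ} (hUu : IsUnit U.det)
    {x : AddUnits StableClass} (hxU : (x : StableClass) = StableClass.mk (castQ U)) {p : ℕ}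
    (hx : x ∈ smoothSubgroup unitOf (p + 1)) : x ∈ smoothSubgroup unitOf p := by
  by_cases hp : p.Prime
  swap
  · exact smoothSubgroup_succ_le hp hx
  obtain ⟨s, c, hc, haniso, hxc⟩ := wittRelations_unitOf.exists_anisotropic hp hx
  obtain ⟨k, b, hb, hxb⟩ := wittRelations_unitOf.exists_sum_eq hxc
  have hp0 : (p : ℤ) ≠ 0 := by exact_mod_cast hp.ne_zero
  have hmk : StableClass.mk (castQ U) = StableClass.mk
      (osum (castQ (diagonal b)) (castQ (diagonal fun i => p * c i))) := by
    rw [mk_osum, ← sum_val_unitOf fun i => (hb i).1,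
      ← sum_val_unitOf fun i => mul_ne_zero hp0 (hc i).1, ← AddUnits.val_add, ← hxb,
      sub_add_cancel, hxU]
  obtain ⟨r, t, r', t', h⟩ := mk_eq_mk.1 hmk
  have hcong : Cong (castQ (osum U (sgn ℤ r t)))
      (castQ (osum (osum (diagonal b) (sgn ℤ r' t')) (diagonal fun i => p * c i))) := by
    simp only [castQ_osum, castQ_sgn]
    exact h.trans ((osum_assoc _ _ _).trans
      (((Cong.refl _).osum (osum_comm _ _)).trans (osum_assoc _ _ _).symm))
  have hdet : ¬ (p : ℤ) ∣ (osum (diagonal b) (sgn ℤ r' t')).det := by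
    rw [osum, det_fromBlocks_zero₂₁, det_diagonal, (isUnit_det_sgn r' t').dvd_mul_right]
    intro hd
    obtain ⟨i, -, hi⟩ := ((Nat.prime_iff_prime_int.1 hp).dvd_finsetProd_iff _).1 hd
    exact (hb i).not_dvd hp hi
  have := isEmpty_of_anisotropic hp (isUnit_det_osum hUu (isUnit_det_sgn r t)) hdet
    (fun i => (hc i).not_dvd hp) haniso hcong
  simpa using hxc

theorem stabTriv_castQ {U : Matrix ι ι ℤ} (hU : U.IsSymm) (hUu : IsUnit U.det) :
    StabTriv (castQ U) := by
  obtain ⟨k, b, hb, hmk⟩ := StableClass.exists_mk_eq_sum (A := castQ U)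
    (by rw [Matrix.IsSymm, ← castQ_transpose, hU.eq]) (isUnit_det_castQ hUu.ne_zero).ne_zero
  set x := ∑ i, StableClass.unitOf (b i)
  have hx : x ∈ smoothSubgroup StableClass.unitOf (2 + ∑ i, (b i).natAbs) := by
    refine sum_mem fun i _ => mem_smoothSubgroup (smooth_of_abs_lt (hb i) ?_)
    have h1 : (b i).natAbs ≤ ∑ i, (b i).natAbs :=
      Finset.single_le_sum (f := fun i => (b i).natAbs) (fun _ _ => Nat.zero_le _)
        (Finset.mem_univ i)
    rw [Int.abs_eq_natAbs]
    exact_mod_cast (by omega : (b i).natAbs < 2 + ∑ i, (b i).natAbs)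
  have hdesc : ∀ n, x ∈ smoothSubgroup StableClass.unitOf (2 + n) →
      x ∈ smoothSubgroup StableClass.unitOf 2 := by
    intro n
    induction n with
    | zero => exact id
    | succ n ih => exact fun h => ih (mem_smoothSubgroup_of_succ hUu hmk.symm h)
  have h0 := StableClass.wittRelations_unitOf.eq_zero_of_mem (hdesc _ hx)
  rw [h0, AddUnits.val_zero] at hmk
  exact StableClass.mk_eq_zero.1 hmk

/-- Unimodular symmetric integral matrices are stably diagonal. -/
theorem stabTriv_of_isUnit_det {U : Matrix ι ι ℤ} (hU : U.IsSymm) (hUu : IsUnit U.det) :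
    StabTriv U :=
  stabTriv_of_castQ hU hUu (stabTriv_castQ hU hUu)

theorem stab_of_linkEq_of_det_ne_zero {S : Matrix ι ι ℤ} (hS : S.IsSymm) {T : Matrix κ κ ℤ}
    (hT : T.IsSymm) (hS0 : S.det ≠ 0) (hT0 : T.det ≠ 0) (h : LinkEq S hS T hT) : Stab S T := by
  obtain ⟨U, V, hU, hV, hUu, hVu, hUV⟩ := exists_cong_of_linkEq hS hT hS0 hT0 h
  exact ((stabTriv_of_isUnit_det hU hUu).osum_left S).symm.trans
    (hUV.stab.trans ((stabTriv_of_isUnit_det hV hVu).osum_left T))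

theorem stab_of_linkEq {A : Matrix ι ι ℤ} (hA : A.IsSymm) {B : Matrix κ κ ℤ} (hB : B.IsSymm)
    (hb : b₁ A = b₁ B) (h : LinkEq A hA B hB) : Stab A B := by
  obtain ⟨k, l, S, hS, hS0, hAS⟩ := exists_cong_zero_osum hA
  obtain ⟨k', l', T, hT, hT0, hBT⟩ := exists_cong_zero_osum hB
  have hk : k = k' := by
    rw [hAS.b₁_eq, hBT.b₁_eq, b₁_osum hS0, b₁_osum hT0, b₁_zero, b₁_zero] at hb
    simpa using hb
  subst hk
  have h0S : (osum (0 : Matrix (Fin k) (Fin k) ℤ) S).IsSymm := isSymm_osum (isSymm_zero) hS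
  have h0T : (osum (0 : Matrix (Fin k) (Fin k) ℤ) T).IsSymm := isSymm_osum (isSymm_zero) hT
  have hST : LinkEq S hS T hT :=
    (linkEq_zero_osum hS h0S).trans ((hAS.linkEq hA h0S).symm.trans
      (h.trans ((hBT.linkEq hB h0T).trans (linkEq_zero_osum hT h0T).symm)))
  exact hAS.stab.trans
    (((Stab.refl _).osum (stab_of_linkEq_of_det_ne_zero hS hT hS0 hT0 hST)).trans hBT.symm.stab)

end Main
end Kirby

theorem mainTheorem6 {n m : ℕ} (A : Matrix (Fin n) (Fin n) ℤ) (A' : Matrix (Fin m) (Fin m) ℤ)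
    (hA : A.IsSymm) (hA' : A'.IsSymm) :
    Kirby.StablyCongruent A A' ↔
      Kirby.b₁ A = Kirby.b₁ A' ∧
        ∃ φ : Kirby.Tor A ≃+ Kirby.Tor A', ∀ s t : Kirby.Tor A,
          Kirby.linkingPairing A' hA' (φ s) (φ t) = Kirby.linkingPairing A hA s t := by
  rw [Kirby.stablyCongruent_iff]
  exact ⟨fun h => h.b₁_eq_and_linkEq hA hA', fun h => Kirby.stab_of_linkEq hA hA' h.1 h.2⟩
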